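/- Let $A$ be a finite-dimensional Hopf algebra over a field $k$ with invertible antipode $S$. Let $A^{\circ}$ be the dual Hopf algebra $A^*$ with the product $\langle\lambda\nu,a\rangle=\langle\lambda\otimes\nu,\Delta(a)\rangle$ and the opposite comultiplication $\langle\Delta(\lambda),a\otimes b\rangle=\langle\lambda,ba\rangle$; its antipode is $\lambda\mapsto\lambda\circ S^{-1}$. Let $D(A)$ be the Drinfeld double: the Hopf algebra containing $A$ and $A^{\circ}$ as sub-Hopf algebras, with $A^{\circ}\otimes A\to D(A)$, $\lambda\otimes y\mapsto\lambda\cdot y$, a linear isomorphism, and with $$y\cdot\lambda=\lambda\bigl(S^{-1}(y''')\,?\,y'\bigr)\cdot y''\qquad(y\in A,\ \lambda\in A^{\circ}).$$ For a Hopf algebra $H$, a left (right) cointegral is $x\in H$ with $hx=\epsilon(h)x$ (respectively $xh=\epsilon(h)x$) for all $h\in H$; the modulus of a finite-dimensional Hopf algebra $H$ is the character $\alpha$ of $H$ with $xh=\alpha(h)x$ for all left cointegrals $x$ and all $h\in H$. Let $\mu\in A^*$ be a left integral, i.e. $(1\otimes\mu)\Delta(h)=\mu(h)1$ for all $h\in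 A$, and let $x\in A$ be a left cointegral, normalized by $\mu(x)=1$. Put $p:=\mu\cdot S^{-1}(x)\in D(A)$. Then: 1. $S(p)=p$. 2. $p$ is a nonzero left and right cointegral of $D(A)$, and the modulus $\alpha_D$ of $D(A)$ is trivial, i.e. the counit is the one and only character of $D(A)$ with the defining property of the modulus. 3. The map $A\otimes A^{\circ}\to D(A)$, $y\otimes\lambda\mapsto y\cdot\lambda$, is a linear isomorphism. Identify $A\otimes A^{*}=\mathrm{End}(A)$ by $(y\otimes\lambda)(z)=\lambda(z)y$, and let $P\in\mathrm{End}(A)$ be the image of $p$ under its inverse $D(A)\to A\otimes A^{*}=\mathrm{End}(A)$. Then $P$ is a projector ($P^2=P$) of rank one whose range is the space of left cointegrals of $A$. Moreover, with $R=\sum_i e_i\otimes f_i\in A\otimes A^{\circ}$ the canonical element ($\{e_i\}$ a basis of $A$, $\{f_i\}$ the dual basis) and $\tau$ the flip, $P$ is the composition $$A\xrightarrow{R\otimes1}A\otimes A^{\circ}\otimes A\xrightarrow{1\otimes\tau}A\otimes A\otimes A^{\circ}\xrightarrow{\cdot\otimes1}A\otimes A^{\circ}\xrightarrow{\Delta\otimes1}A\otimes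 A\otimes A^{\circ}\xrightarrow{1\otimes\tau}A\otimes A^{\circ}\otimes A\xrightarrow{1\otimes1\otimes S^2}A\otimes A^{\circ}\otimes A\xrightarrow{1\otimes\langle\,,\rangle}A,$$ that is, $P(y)=\sum_i\bigl\langle f_i,S^2\bigl((e_iy)''\bigr)\bigr\rangle\,(e_iy)'$. -/

import Mathlib

open scoped TensorProduct

namespace HopfDouble
open Coalgebra HopfAlgebra

/-- The standing assumption that the antipode of the Hopf algebra `A` is invertible. -/
class InvertibleAntipode (k A : Type*) [Field k] [Ring A] [HopfAlgebra k A] : Prop where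
  bijective : Function.Bijective (antipode k (A := A))

section Dual

variable (k A : Type*) [Field k] [Ring A] [HopfAlgebra k A]

/-- The inverse `S⁻¹` of the antipode. -/
noncomputable def antipodeInv [InvertibleAntipode k A] : A →ₗ[k] A :=
  (LinearEquiv.ofBijective (antipode k (A := A)) InvertibleAntipode.bijective).symm

/-- The carrier of the dual Hopf algebra `A°`, i.e. the linear dual of `A`, with
the convolution product `⟨λ ν, a⟩ = ⟨λ, a'⟩ ⟨ν, a''⟩`. -/
def CopDual : Type _ := WithConv (Module.Dual k A)

noncomputable instance : Ring (CopDual k A) :=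
  inferInstanceAs (Ring (WithConv (A →ₗ[k] k)))

noncomputable instance : Algebra k (CopDual k A) :=
  inferInstanceAs (Algebra k (WithConv (A →ₗ[k] k)))

/-- `A°` as a vector space is the linear dual of `A`. -/
noncomputable def toDual : CopDual k A ≃ₗ[k] Module.Dual k A :=
  WithConv.linearEquiv k (Module.Dual k A)

variable {k A}

theorem antipode_antipodeInv [InvertibleAntipode k A] (a : A) :
    antipode k (antipodeInv k A a) = a :=
  (LinearEquiv.ofBijective (antipode k (A := A)) InvertibleAntipode.bijective).apply_symm_apply a

theorem antipode_injective [InvertibleAntipode k A] :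
    Function.Injective (antipode k (A := A)) :=
  InvertibleAntipode.bijective.1

theorem antipodeInv_antipode [InvertibleAntipode k A] (a : A) :
    antipodeInv k A (antipode k a) = a :=
  antipode_injective (antipode_antipodeInv _)

theorem antipodeInv_mul [InvertibleAntipode k A] (a b : A) :
    antipodeInv k A (a * b) = antipodeInv k A b * antipodeInv k A a :=
  antipode_injective (k := k) (by
    rw [antipode_mul_antidistrib]; simp only [antipode_antipodeInv])

theorem antipodeInv_one [InvertibleAntipode k A] : antipodeInv k A (1 : A) = 1 :=
  antipode_injective (k := k) (by rw [antipode_antipodeInv, antipode_one])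

theorem sum_mul_antipodeInv [InvertibleAntipode k A] {ι : Type*} {a : A}
    (r : Coalgebra.Repr k a ι) :
    ∑ i ∈ r.index, r.right i * antipodeInv k A (r.left i) = counit (R := k) a • 1 := by
  apply antipode_injective (k := k)
  simp only [map_sum, antipode_mul_antidistrib, antipode_antipodeInv, map_smul, antipode_one]
  exact sum_mul_antipode_eq_smul r

theorem sum_antipodeInv_mul [InvertibleAntipode k A] {ι : Type*} {a : A}
    (r : Coalgebra.Repr k a ι) :
    ∑ i ∈ r.index, antipodeInv k A (r.right i) * r.left i = counit (R := k) a • 1 := by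
  apply antipode_injective (k := k)
  simp only [map_sum, antipode_mul_antidistrib, antipode_antipodeInv, map_smul, antipode_one]
  exact sum_antipode_mul_eq_smul r

theorem toDual_mul (l m : CopDual k A) {ι : Type*} {a : A} (r : Coalgebra.Repr k a ι) :
    toDual k A (l * m) a = ∑ i ∈ r.index, toDual k A l (r.left i) * toDual k A m (r.right i) :=
  Coalgebra.Repr.convMul_apply r _ _

theorem toDual_one (a : A) : toDual k A 1 a = counit (R := k) a := rfl

theorem CopDual.ext {l m : CopDual k A} (h : ∀ a, toDual k A l a = toDual k A m a) : l = m :=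
  (toDual k A).injective (LinearMap.ext h)

variable (k A) in
/-- The counit of `A°`: evaluation at `1`. -/
noncomputable def dualCounit : CopDual k A →ₗ[k] k :=
  LinearMap.applyₗ (1 : A) ∘ₗ (toDual k A).toLinearMap

theorem dualCounit_apply (l : CopDual k A) : dualCounit k A l = toDual k A l 1 := rfl

variable (k A) in
/-- The antipode of `A°`: the transpose of `S⁻¹`. -/
noncomputable def dualAntipode [InvertibleAntipode k A] : CopDual k A →ₗ[k] CopDual k A :=
  (toDual k A).symm.toLinearMap ∘ₗ (antipodeInv k A).dualMap ∘ₗ (toDual k A).toLinearMap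

theorem toDual_dualAntipode [InvertibleAntipode k A] (l : CopDual k A) (a : A) :
    toDual k A (dualAntipode k A l) a = toDual k A l (antipodeInv k A a) := by
  simp [dualAntipode]

variable [FiniteDimensional k A]

variable (k A) in
/-- The pairing of `A° ⊗ A°` with `A ⊗ A`. -/
noncomputable def pair2 : CopDual k A ⊗[k] CopDual k A ≃ₗ[k] Module.Dual k (A ⊗[k] A) :=
  TensorProduct.congr (toDual k A) (toDual k A) ≪≫ₗ TensorProduct.dualDistribEquiv k A A

theorem pair2_tmul (l m : CopDual k A) (a b : A) :
    pair2 k A (l ⊗ₜ m) (a ⊗ₜ b) = toDual k A l a * toDual k A m b := by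
  rfl

theorem pair2_ext {s t : CopDual k A ⊗[k] CopDual k A}
    (h : ∀ a b, pair2 k A s (a ⊗ₜ b) = pair2 k A t (a ⊗ₜ b)) : s = t :=
  (pair2 k A).injective (TensorProduct.ext' h)

variable (k A) in
/-- The (opposite) comultiplication of `A°`: `⟨Δ λ, a ⊗ b⟩ = ⟨λ, b a⟩`. -/
noncomputable def dualComul : CopDual k A →ₗ[k] CopDual k A ⊗[k] CopDual k A :=
  (pair2 k A).symm.toLinearMap ∘ₗ
    (LinearMap.mul' k A ∘ₗ (TensorProduct.comm k A A).toLinearMap).dualMap ∘ₗ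
      (toDual k A).toLinearMap

theorem pair2_dualComul (l : CopDual k A) (a b : A) :
    pair2 k A (dualComul k A l) (a ⊗ₜ b) = toDual k A l (b * a) := by
  simp [dualComul]

variable (k A) in
/-- The pairing of `A° ⊗ (A° ⊗ A°)` with `A ⊗ (A ⊗ A)`. -/
noncomputable def pair3 : CopDual k A ⊗[k] (CopDual k A ⊗[k] CopDual k A) ≃ₗ[k]
    Module.Dual k (A ⊗[k] (A ⊗[k] A)) :=
  TensorProduct.congr (toDual k A) (pair2 k A) ≪≫ₗ TensorProduct.dualDistribEquiv k A (A ⊗[k] A)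

theorem pair3_tmul (l : CopDual k A) (t : CopDual k A ⊗[k] CopDual k A) (a : A) (b : A ⊗[k] A) :
    pair3 k A (l ⊗ₜ t) (a ⊗ₜ b) = toDual k A l a * pair2 k A t b := by
  rfl

noncomputable instance : Coalgebra k (CopDual k A) where
  comul := dualComul k A
  counit := dualCounit k A
  coassoc := by
    ext l
    apply (pair3 k A).injective
    have h1 : ∀ (t : CopDual k A ⊗[k] CopDual k A) (a b c : A),
        pair3 k A ((dualComul k A).lTensor _ t) (a ⊗ₜ (b ⊗ₜ c)) = pair2 k A t (a ⊗ₜ (c * b)) := by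
      intro t a b c
      induction t with
      | zero => simp
      | add x y hx hy => simp [hx, hy]
      | tmul x y => simp [pair3_tmul, pair2_tmul, pair2_dualComul]
    have h3 : ∀ (s : CopDual k A ⊗[k] CopDual k A) (y : CopDual k A) (a b c : A),
        pair3 k A (TensorProduct.assoc k _ _ _ (s ⊗ₜ y)) (a ⊗ₜ (b ⊗ₜ c)) =
          pair2 k A s (a ⊗ₜ b) * toDual k A y c := by
      intro s y a b c
      induction s with
      | zero => simp
      | add x y hx hy => simp [TensorProduct.add_tmul, hx, hy, add_mul]
      | tmul x y => simp [pair3_tmul, pair2_tmul, mul_assoc]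
    have h2 : ∀ (t : CopDual k A ⊗[k] CopDual k A) (a b c : A),
        pair3 k A (TensorProduct.assoc k _ _ _ ((dualComul k A).rTensor _ t)) (a ⊗ₜ (b ⊗ₜ c)) =
          pair2 k A t ((b * a) ⊗ₜ c) := by
      intro t a b c
      induction t with
      | zero => simp
      | add x y hx hy => simp [hx, hy]
      | tmul x y => simp [h3, pair2_tmul, pair2_dualComul]
    apply TensorProduct.ext
    ext a b c
    have := h2 (dualComul k A l) a b c
    have h4 := h1 (dualComul k A l) a b c
    simp only [pair2_dualComul] at this h4
    simpa [mul_assoc] using this.trans (by rw [h4, mul_assoc])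
  rTensor_counit_comp_comul := by
    ext l
    apply (TensorProduct.lid k _).injective
    have h : ∀ t : CopDual k A ⊗[k] CopDual k A, ∀ a,
        toDual k A (TensorProduct.lid k _ ((dualCounit k A).rTensor _ t)) a =
          pair2 k A t (1 ⊗ₜ a) := by
      intro t a
      induction t with
      | zero => simp
      | add x y hx hy => simp [hx, hy]
      | tmul x y => simp [pair2_tmul, dualCounit_apply]
    apply CopDual.ext
    intro a
    simpa [pair2_dualComul] using h (dualComul k A l) a
  lTensor_counit_comp_comul := by
    ext l
    apply (TensorProduct.rid k _).injective
    have h : ∀ t : CopDual k A ⊗[k] CopDual k A, ∀ a,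
        toDual k A (TensorProduct.rid k _ ((dualCounit k A).lTensor _ t)) a =
          pair2 k A t (a ⊗ₜ 1) := by
      intro t a
      induction t with
      | zero => simp
      | add x y hx hy => simp [hx, hy]
      | tmul x y => simp [pair2_tmul, dualCounit_apply, mul_comm]
    apply CopDual.ext
    intro a
    simpa [pair2_dualComul] using h (dualComul k A l) a

theorem pair2_comul (l : CopDual k A) (a b : A) :
    pair2 k A (comul l) (a ⊗ₜ b) = toDual k A l (b * a) := pair2_dualComul l a b

theorem counit_dual (l : CopDual k A) : counit (R := k) l = toDual k A l 1 := rfl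

theorem pair2_mul (s t : CopDual k A ⊗[k] CopDual k A) {ι κ : Type*} {a b : A}
    (r : Coalgebra.Repr k a ι) (r' : Coalgebra.Repr k b κ) :
    pair2 k A (s * t) (a ⊗ₜ b) = ∑ i ∈ r.index, ∑ j ∈ r'.index,
      pair2 k A s (r.left i ⊗ₜ r'.left j) * pair2 k A t (r.right i ⊗ₜ r'.right j) := by
  induction s with
  | zero => simp
  | add x y hx hy => simp [add_mul, hx, hy, Finset.sum_add_distrib]
  | tmul l m =>
    induction t with
    | zero => simp
    | add x y hx hy => simp [mul_add, hx, hy, Finset.sum_add_distrib]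
    | tmul l' m' =>
      simp only [Algebra.TensorProduct.tmul_mul_tmul, pair2_tmul, toDual_mul _ _ r,
        toDual_mul _ _ r', Finset.sum_mul_sum]
      exact Finset.sum_congr rfl fun i _ => Finset.sum_congr rfl fun j _ => by ring

noncomputable instance : Bialgebra k (CopDual k A) :=
  Bialgebra.mk' k (CopDual k A)
    (by rw [counit_dual, toDual_one, Bialgebra.counit_one])
    (by
      intro l m
      simp only [counit_dual]
      have h := LinearMap.convMul_apply (R := k) (A := k) (C := A) l m 1
      rw [Bialgebra.comul_one, Algebra.TensorProduct.one_def] at h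
      simp only [TensorProduct.map_tmul, LinearMap.mul'_apply] at h
      exact h)
    (by
      apply pair2_ext
      intro a b
      rw [pair2_comul, Algebra.TensorProduct.one_def, pair2_tmul]
      simp [toDual_one, mul_comm])
    (by
      intro l m
      apply pair2_ext
      intro a b
      rw [pair2_comul, pair2_mul _ _ (ℛ k a) (ℛ k b), toDual_mul _ _ ((ℛ k b).mul (ℛ k a))]
      simp only [pair2_comul]
      rw [Finset.sum_comm]
      simp [Coalgebra.Repr.mul, Coalgebra.Repr.tmul, Finset.sum_product])

variable [InvertibleAntipode k A]

/-- The dual Hopf algebra `A°` with opposite comultiplication. -/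
noncomputable instance : HopfAlgebra k (CopDual k A) where
  antipode := dualAntipode k A
  mul_antipode_rTensor_comul := by
    ext l
    apply CopDual.ext
    intro a
    have h : ∀ t : CopDual k A ⊗[k] CopDual k A,
        toDual k A (LinearMap.mul' k _ ((dualAntipode k A).rTensor _ t)) a =
          ∑ i ∈ (ℛ k a).index,
            pair2 k A t (antipodeInv k A ((ℛ k a).left i) ⊗ₜ (ℛ k a).right i) := by
      intro t
      induction t with
      | zero => simp
      | add x y hx hy => simp [hx, hy, Finset.sum_add_distrib]
      | tmul x y => simp [toDual_mul _ _ (ℛ k a), pair2_tmul, toDual_dualAntipode]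
    have h2 := h (comul l)
    simp only [pair2_comul, ← map_sum, sum_mul_antipodeInv] at h2
    simpa [Algebra.algebraMap_eq_smul_one, counit_dual, toDual_one, mul_comm] using h2
  mul_antipode_lTensor_comul := by
    ext l
    apply CopDual.ext
    intro a
    have h : ∀ t : CopDual k A ⊗[k] CopDual k A,
        toDual k A (LinearMap.mul' k _ ((dualAntipode k A).lTensor _ t)) a =
          ∑ i ∈ (ℛ k a).index,
            pair2 k A t ((ℛ k a).left i ⊗ₜ antipodeInv k A ((ℛ k a).right i)) := by
      intro t
      induction t with
      | zero => simp
      | add x y hx hy => simp [hx, hy, Finset.sum_add_distrib]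
      | tmul x y => simp [toDual_mul _ _ (ℛ k a), pair2_tmul, toDual_dualAntipode]
    have h2 := h (comul l)
    simp only [pair2_comul, ← map_sum, sum_antipodeInv_mul] at h2
    simpa [Algebra.algebraMap_eq_smul_one, counit_dual, toDual_one, mul_comm] using h2

end Dual

section Double

open WithConv

/-! ### Auxiliary facts on convolution products -/

section Aux

variable {k A : Type*} [Field k] [Ring A] [HopfAlgebra k A]

/-- The pointwise (convolution) product `a ↦ f(a') g(a'')` of two commuting representations. -/
noncomputable def convAlgHom {E : Type*} [Semiring E] [Algebra k E] (f g : A →ₐ[k] E)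
    (h : ∀ a b, Commute (f a) (g b)) : A →ₐ[k] E :=
  (Algebra.TensorProduct.lift f g h).comp (Bialgebra.comulAlgHom k A)

theorem convAlgHom_apply {E : Type*} [Semiring E] [Algebra k E] (f g : A →ₐ[k] E)
    (h : ∀ a b, Commute (f a) (g b)) {ι : Type*} {a : A} (r : Coalgebra.Repr k a ι) :
    convAlgHom f g h a = ∑ i ∈ r.index, f (r.left i) * g (r.right i) := by
  change Algebra.TensorProduct.lift f g h (comul a) = _
  rw [← r.eq, map_sum]
  simp

theorem commute_convAlgHom {E : Type*} [Semiring E] [Algebra k E] {f g : A →ₐ[k] E}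
    {h : ∀ a b, Commute (f a) (g b)} {x : E} (hf : ∀ a, Commute x (f a))
    (hg : ∀ a, Commute x (g a)) (a : A) : Commute x (convAlgHom f g h a) := by
  rw [convAlgHom_apply _ _ _ (ℛ k a)]
  exact Commute.sum_right _ _ _ fun i _ => (hf _).mul_right (hg _)

theorem convAlgHom_toConv {E : Type*} [Semiring E] [Algebra k E] (f g : A →ₐ[k] E)
    (h : ∀ a b, Commute (f a) (g b)) :
    toConv (convAlgHom f g h).toLinearMap = toConv f.toLinearMap * toConv g.toLinearMap := by
  ext a
  rw [(ℛ k a).convMul_apply]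
  exact convAlgHom_apply f g h (ℛ k a)

/-- `M` intertwines the operators `g a` with the operators `f a`. -/
def Intertwines {V W : Type*} [AddCommGroup V] [Module k V] [AddCommGroup W] [Module k W]
    (M : W →ₗ[k] V) (g : WithConv (A →ₗ[k] Module.End k W))
    (f : WithConv (A →ₗ[k] Module.End k V)) : Prop :=
  ∀ a w, M (g a w) = f a (M w)

theorem Intertwines.mul {V W : Type*} [AddCommGroup V] [Module k V] [AddCommGroup W] [Module k W]
    {M : W →ₗ[k] V} {g g' : WithConv (A →ₗ[k] Module.End k W)}
    {f f' : WithConv (A →ₗ[k] Module.End k V)} (h : Intertwines M g f) (h' : Intertwines M g' f') :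
    Intertwines M (g * g') (f * f') := by
  intro a w
  rw [(ℛ k a).convMul_apply, (ℛ k a).convMul_apply]
  simp [h _ _, h' _ _]

theorem comul_antipode (a : A) : comul (antipode k a) =
    TensorProduct.map (antipode k) (antipode k) (TensorProduct.comm k A A (comul (R := k) a)) := by
  let i1 : A →ₐ[k] A ⊗[k] A := Algebra.TensorProduct.includeLeft
  let i2 : A →ₐ[k] A ⊗[k] A := Algebra.TensorProduct.includeRight
  have hone (i : A →ₐ[k] A ⊗[k] A) : toConv (i.toLinearMap ∘ₗ antipode k) *
      toConv i.toLinearMap = 1 := by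
    have h := LinearMap.algHom_comp_convMul_distrib i (toConv (antipode k (A := A)))
      (toConv LinearMap.id)
    rw [LinearMap.antipode_mul_id] at h
    refine WithConv.ext (h.symm.trans ?_)
    ext a
    simp
  have hd : toConv (comul (R := k) (A := A)) = toConv i1.toLinearMap * toConv i2.toLinearMap := by
    ext a
    rw [(ℛ k a).convMul_apply]
    simp [i1, i2, (ℛ k a).eq]
  have hG : toConv (TensorProduct.map (antipode k) (antipode k) ∘ₗ
      (TensorProduct.comm k A A).toLinearMap ∘ₗ comul) =
      toConv (i2.toLinearMap ∘ₗ antipode k) * toConv (i1.toLinearMap ∘ₗ antipode k) := by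
    ext a
    rw [(ℛ k a).convMul_apply]
    simp only [LinearMap.comp_apply, ← (ℛ k a).eq, map_sum]
    simp [i1, i2]
  have hl : toConv (TensorProduct.map (antipode k) (antipode k) ∘ₗ
      (TensorProduct.comm k A A).toLinearMap ∘ₗ comul) * toConv (comul (R := k) (A := A)) = 1 := by
    rw [hG, hd, mul_assoc, ← mul_assoc (toConv (i1.toLinearMap ∘ₗ antipode k)), hone, one_mul,
      hone]
  have := left_inv_eq_right_inv hl LinearMap.comul_right_inv
  exact (LinearMap.congr_fun (congrArg WithConv.ofConv this) a).symm

theorem comul_antipodeInv [InvertibleAntipode k A] (a : A) : comul (antipodeInv k A a) =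
    TensorProduct.map (antipodeInv k A) (antipodeInv k A)
      (TensorProduct.comm k A A (comul (R := k) a)) := by
  have h := comul_antipode (k := k) (antipodeInv k A a)
  rw [antipode_antipodeInv] at h
  rw [h]
  generalize comul (R := k) (antipodeInv k A a) = t
  induction t with
  | zero => simp
  | add x y hx hy => simp only [map_add, ← hx, ← hy]
  | tmul x y => simp [antipodeInv_antipode]

/-- `Δ(S⁻¹ a) = S⁻¹ a'' ⊗ S⁻¹ a'`. -/
noncomputable def reprInv [InvertibleAntipode k A] {ι : Type*} {a : A}
    (r : Coalgebra.Repr k a ι) : Coalgebra.Repr k (antipodeInv k A a) ι where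
  index := r.index
  left i := antipodeInv k A (r.right i)
  right i := antipodeInv k A (r.left i)
  eq := by
    rw [comul_antipodeInv, ← r.eq]
    simp

end Aux

/-! ### The actions of `A` on `A° ⊗ U` -/

section Act

variable (k A : Type*) [Field k] [Ring A] [HopfAlgebra k A]

/-- The action `(a ▷ λ)(z) = λ(z a)` of `A` on `A°`. -/
noncomputable def rightShift : A →ₐ[k] Module.End k (CopDual k A) :=
  AlgHom.ofLinearMap
    { toFun := fun a => (toDual k A).symm.toLinearMap ∘ₗ
        (LinearMap.mulRight k a).dualMap ∘ₗ (toDual k A).toLinearMap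
      map_add' := fun a b => by
        ext l; apply CopDual.ext; intro z; simp [mul_add]
      map_smul' := fun c a => by
        ext l; apply CopDual.ext; intro z; simp }
    (by ext l; apply CopDual.ext; intro z; simp)
    (fun a b => by ext l; apply CopDual.ext; intro z; simp [mul_assoc])

/-- The action `(λ ◁ S⁻¹(a))(z) = λ(S⁻¹(a) z)` of `A` on `A°`. -/
noncomputable def leftShift [InvertibleAntipode k A] : A →ₐ[k] Module.End k (CopDual k A) :=
  AlgHom.ofLinearMap
    { toFun := fun a => (toDual k A).symm.toLinearMap ∘ₗ
        (LinearMap.mulLeft k (antipodeInv k A a)).dualMap ∘ₗ (toDual k A).toLinearMap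
      map_add' := fun a b => by
        ext l; apply CopDual.ext; intro z; simp [add_mul]
      map_smul' := fun c a => by
        ext l; apply CopDual.ext; intro z; simp }
    (by ext l; apply CopDual.ext; intro z; simp [antipodeInv_one])
    (fun a b => by ext l; apply CopDual.ext; intro z; simp [antipodeInv_mul])

variable {k A}

theorem rightShift_apply (a : A) (l : CopDual k A) (z : A) :
    toDual k A (rightShift k A a l) z = toDual k A l (z * a) := by
  simp [rightShift]

theorem leftShift_apply [InvertibleAntipode k A] (a : A) (l : CopDual k A) (z : A) :
    toDual k A (leftShift k A a l) z = toDual k A l (antipodeInv k A a * z) := by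
  simp [leftShift]

theorem rightShift_mul (l m : CopDual k A) {ι : Type*} {a : A} (r : Coalgebra.Repr k a ι) :
    rightShift k A a (l * m) =
      ∑ i ∈ r.index, rightShift k A (r.left i) l * rightShift k A (r.right i) m := by
  apply CopDual.ext; intro z
  rw [rightShift_apply, toDual_mul _ _ ((ℛ k z).mul r)]
  simp only [map_sum, LinearMap.sum_apply, toDual_mul _ _ (ℛ k z), rightShift_apply]
  rw [Finset.sum_comm]
  simp [Coalgebra.Repr.mul, Coalgebra.Repr.tmul, Finset.sum_product]

theorem leftShift_mul [InvertibleAntipode k A] (l m : CopDual k A) {ι : Type*} {a : A}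
    (r : Coalgebra.Repr k a ι) :
    leftShift k A a (l * m) =
      ∑ i ∈ r.index, leftShift k A (r.right i) l * leftShift k A (r.left i) m := by
  apply CopDual.ext; intro z
  rw [leftShift_apply, toDual_mul _ _ ((reprInv r).mul (ℛ k z))]
  simp only [map_sum, LinearMap.sum_apply, toDual_mul _ _ (ℛ k z), leftShift_apply]
  simp [Coalgebra.Repr.mul, Coalgebra.Repr.tmul, Finset.sum_product, reprInv]

variable (U : Type*) [AddCommGroup U] [Module k U]

/-- `a ↦ rightShift a ⊗ 1` on `A° ⊗ U`. -/
noncomputable def repR : A →ₐ[k] Module.End k (CopDual k A ⊗[k] U) :=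
  (Module.End.rTensorAlgHom k (CopDual k A) U).comp (rightShift k A)

/-- `a ↦ leftShift a ⊗ 1` on `A° ⊗ U`. -/
noncomputable def repL [InvertibleAntipode k A] :
    A →ₐ[k] Module.End k (CopDual k A ⊗[k] U) :=
  (Module.End.rTensorAlgHom k (CopDual k A) U).comp (leftShift k A)

variable {U}

/-- `a ↦ 1 ⊗ ρ(a)` on `A° ⊗ U`. -/
noncomputable def repM (ρ : A →ₐ[k] Module.End k U) :
    A →ₐ[k] Module.End k (CopDual k A ⊗[k] U) :=
  (Module.End.lTensorAlgHom k U (CopDual k A)).comp ρ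

theorem repR_tmul (a : A) (l : CopDual k A) (u : U) :
    repR U a (l ⊗ₜ u) = rightShift k A a l ⊗ₜ u := rfl

theorem repL_tmul [InvertibleAntipode k A] (a : A) (l : CopDual k A) (u : U) :
    repL U a (l ⊗ₜ u) = leftShift k A a l ⊗ₜ u := rfl

theorem repM_tmul (ρ : A →ₐ[k] Module.End k U) (a : A) (l : CopDual k A) (u : U) :
    repM ρ a (l ⊗ₜ u) = l ⊗ₜ ρ a u := rfl

theorem commute_ML [InvertibleAntipode k A] (ρ : A →ₐ[k] Module.End k U) (a b : A) :
    Commute (repM ρ a) (repL U b) :=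
  TensorProduct.ext' fun l u => by
    simp only [Module.End.mul_apply, repM_tmul, repL_tmul]

theorem commute_RM (ρ : A →ₐ[k] Module.End k U) (a b : A) :
    Commute (repR U a) (repM ρ b) :=
  TensorProduct.ext' fun l u => by
    simp only [Module.End.mul_apply, repM_tmul, repR_tmul]

theorem commute_RL [InvertibleAntipode k A] (a b : A) :
    Commute (repR (k := k) U a) (repL U b) :=
  TensorProduct.ext' fun l u => by
    simp only [Module.End.mul_apply, repL_tmul, repR_tmul]
    congr 1
    apply CopDual.ext; intro z
    simp [rightShift_apply, leftShift_apply, mul_assoc]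

variable (k A U) in
/-- `λ ⊗ (ν ⊗ u) ↦ λν ⊗ u`. -/
noncomputable def mulFst : CopDual k A ⊗[k] (CopDual k A ⊗[k] U) →ₗ[k] CopDual k A ⊗[k] U :=
  (LinearMap.mul' k (CopDual k A)).rTensor U ∘ₗ
    (TensorProduct.assoc k (CopDual k A) (CopDual k A) U).symm.toLinearMap

theorem mulFst_tmul (l m : CopDual k A) (u : U) :
    mulFst k A U (l ⊗ₜ (m ⊗ₜ u)) = (l * m) ⊗ₜ u := by
  simp [mulFst]

variable [InvertibleAntipode k A]

/-- For an `A`-module `(U, ρ)`, the action of `A` on `A° ⊗ U` given by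
`y (λ ⊗ u) = λ(S⁻¹(y''') ? y') ⊗ ρ(y'') u`. -/
noncomputable def act (ρ : A →ₐ[k] Module.End k U) : A →ₐ[k] Module.End k (CopDual k A ⊗[k] U) :=
  convAlgHom (repR U) (convAlgHom (repM ρ) (repL U) (commute_ML ρ))
    (fun a b => commute_convAlgHom (commute_RM ρ a) (commute_RL a) b)

theorem act_toConv (ρ : A →ₐ[k] Module.End k U) :
    toConv (act ρ).toLinearMap = toConv (repR U).toLinearMap *
      (toConv (repM ρ).toLinearMap * toConv (repL U).toLinearMap) := by
  rw [act, convAlgHom_toConv, convAlgHom_toConv]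

theorem act_natural {U' : Type*} [AddCommGroup U'] [Module k U'] (ρ : A →ₐ[k] Module.End k U)
    (ρ' : A →ₐ[k] Module.End k U') (j : U →ₗ[k] U') (h : ∀ a u, j (ρ a u) = ρ' a (j u))
    (a : A) (v : CopDual k A ⊗[k] U) :
    j.lTensor _ (act ρ a v) = act ρ' a (j.lTensor _ v) := by
  suffices Intertwines (j.lTensor (CopDual k A)) (toConv (act ρ).toLinearMap)
    (toConv (act ρ').toLinearMap) from this a v
  rw [act_toConv, act_toConv]
  refine .mul ?_ (.mul ?_ ?_) <;> intro a w
  · change j.lTensor _ (repR U a w) = repR U' a (j.lTensor _ w)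
    induction w with
    | zero => simp
    | add x y hx hy => simp only [map_add, hx, hy]
    | tmul x y => simp [repR_tmul]
  · change j.lTensor _ (repM ρ a w) = repM ρ' a (j.lTensor _ w)
    induction w with
    | zero => simp
    | add x y hx hy => simp only [map_add, hx, hy]
    | tmul x y => simp [repM_tmul, h]
  · change j.lTensor _ (repL U a w) = repL U' a (j.lTensor _ w)
    induction w with
    | zero => simp
    | add x y hx hy => simp only [map_add, hx, hy]
    | tmul x y => simp [repL_tmul]

theorem act_mulFst (ρ : A →ₐ[k] Module.End k U) (a : A)
    (v : CopDual k A ⊗[k] (CopDual k A ⊗[k] U)) :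
    mulFst k A U (act (act ρ) a v) = act ρ a (mulFst k A U v) := by
  let s := Module.End.lTensorAlgHom k (CopDual k A ⊗[k] U) (CopDual k A)
  suffices Intertwines (mulFst k A U) (toConv (act (act ρ)).toLinearMap)
    (toConv (act ρ).toLinearMap) from this a v
  have h2 : toConv (repM (act ρ)).toLinearMap = toConv (s.toLinearMap ∘ₗ (repR U).toLinearMap) *
      (toConv (s.toLinearMap ∘ₗ (repM ρ).toLinearMap) *
        toConv (s.toLinearMap ∘ₗ (repL U).toLinearMap)) := by
    have h3 : (repM (act ρ)).toLinearMap = s.toLinearMap ∘ₗ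
      (toConv (act ρ).toLinearMap).ofConv := rfl
    rw [h3, act_toConv, LinearMap.algHom_comp_convMul_distrib,
      LinearMap.algHom_comp_convMul_distrib]
  rw [act_toConv, act_toConv, h2, mul_assoc, mul_assoc, ← mul_assoc]
  refine .mul ?_ (.mul ?_ ?_) <;> intro a w
  · rw [(ℛ k a).convMul_apply, LinearMap.sum_apply, map_sum]
    change ∑ i ∈ (ℛ k a).index, mulFst k A U (repR _ ((ℛ k a).left i)
      ((repR U ((ℛ k a).right i)).lTensor _ w)) = repR U a (mulFst k A U w)
    induction w with
    | zero => simp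
    | add x y hx hy => simp only [map_add, Finset.sum_add_distrib, hx, hy]
    | tmul x y =>
      induction y with
      | zero => simp
      | add x y hx hy => simp only [TensorProduct.tmul_add, map_add, Finset.sum_add_distrib, hx, hy]
      | tmul y z =>
        simp [mulFst_tmul, repR_tmul, rightShift_mul _ _ (ℛ k a), TensorProduct.sum_tmul]
  · change mulFst k A U ((repM ρ a).lTensor _ w) = repM ρ a (mulFst k A U w)
    induction w with
    | zero => simp
    | add x y hx hy => simp only [map_add, hx, hy]
    | tmul x y =>
      induction y with
      | zero => simp
      | add x y hx hy => simp only [TensorProduct.tmul_add, map_add, hx, hy]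
      | tmul y z => simp [mulFst_tmul, repM_tmul]
  · rw [(ℛ k a).convMul_apply, LinearMap.sum_apply, map_sum]
    change ∑ i ∈ (ℛ k a).index, mulFst k A U ((repL U ((ℛ k a).left i)).lTensor _
      (repL _ ((ℛ k a).right i) w)) = repL U a (mulFst k A U w)
    induction w with
    | zero => simp
    | add x y hx hy => simp only [map_add, Finset.sum_add_distrib, hx, hy]
    | tmul x y =>
      induction y with
      | zero => simp
      | add x y hx hy => simp only [TensorProduct.tmul_add, map_add, Finset.sum_add_distrib, hx, hy]
      | tmul y z =>
        simp [mulFst_tmul, repL_tmul, leftShift_mul _ _ (ℛ k a), TensorProduct.sum_tmul]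

end Act
end Double

/-! ### The double -/

section DrinfeldDouble

open WithConv

variable (k A : Type*) [Field k] [Ring A] [HopfAlgebra k A]

/-- The Drinfeld double `D(A)`: the coalgebra `A° ⊗ A` with the bicrossed product, where
`λ ⊗ y` stands for the product `λ · y`. -/
def DrinfeldDouble : Type _ := CopDual k A ⊗[k] A

namespace DrinfeldDouble

noncomputable instance : AddCommGroup (DrinfeldDouble k A) :=
  inferInstanceAs (AddCommGroup (CopDual k A ⊗[k] A))

noncomputable instance : Module k (DrinfeldDouble k A) :=
  inferInstanceAs (Module k (CopDual k A ⊗[k] A))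

/-- The coalgebra structure of `D(A)` is that of the tensor product of `A°` and `A`. -/
noncomputable instance [FiniteDimensional k A] : Coalgebra k (DrinfeldDouble k A) :=
  inferInstanceAs (Coalgebra k (CopDual k A ⊗[k] A))

/-- The element `λ · y` of `D(A)`. -/
noncomputable def of : CopDual k A ⊗[k] A ≃ₗ[k] DrinfeldDouble k A := LinearEquiv.refl k _

/-- The left regular action of `A° ⊗ A` on itself:
`(λ · y) (ν · b) = λ ν(S⁻¹(y''') ? y') · y'' b`. -/
noncomputable def regular [InvertibleAntipode k A] :
    CopDual k A ⊗[k] A →ₗ[k] Module.End k (CopDual k A ⊗[k] A) :=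
  TensorProduct.lift ((LinearMap.mul k (Module.End k (CopDual k A ⊗[k] A))).compl₁₂
    ((Module.End.rTensorAlgHom k (CopDual k A) A).toLinearMap ∘ₗ
      LinearMap.mul k (CopDual k A))
    (act (Algebra.lmul k A)).toLinearMap)

variable {k A}

theorem rightShift_one (a : A) : rightShift k A a 1 = counit (R := k) a • 1 := by
  apply CopDual.ext; intro z
  rw [rightShift_apply, map_smul, LinearMap.smul_apply, toDual_one, toDual_one,
    Bialgebra.counit_mul, smul_eq_mul, mul_comm]

noncomputable instance : One (DrinfeldDouble k A) where
  one := of k A (1 ⊗ₜ 1)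

theorem one_def : (1 : DrinfeldDouble k A) = of k A (1 ⊗ₜ 1) := rfl

variable [InvertibleAntipode k A]

theorem regular_tmul (l : CopDual k A) (y : A) (v : CopDual k A ⊗[k] A) :
    regular k A (l ⊗ₜ y) v = (LinearMap.mulLeft k l).rTensor A (act (Algebra.lmul k A) y v) := rfl

theorem regular_eq (x v : CopDual k A ⊗[k] A) :
    regular k A x v = mulFst k A A
      (((act (Algebra.lmul k A)).toLinearMap.flip v).lTensor (CopDual k A) x) := by
  induction x with
  | zero => simp
  | add x y hx hy => simp only [map_add, LinearMap.add_apply, hx, hy]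
  | tmul l y =>
    rw [regular_tmul]
    simp only [LinearMap.lTensor_tmul, LinearMap.flip_apply, AlgHom.toLinearMap_apply]
    generalize act (Algebra.lmul k A) y v = w
    induction w with
    | zero => simp
    | add x y hx hy => simp only [TensorProduct.tmul_add, map_add, hx, hy]
    | tmul m z => simp [mulFst_tmul]

theorem act_regular (a : A) (x v : CopDual k A ⊗[k] A) :
    act (Algebra.lmul k A) a (regular k A x v) =
      regular k A (act (Algebra.lmul k A) a x) v := by
  rw [regular_eq, regular_eq, ← act_mulFst]
  congr 1
  refine (act_natural _ _ _ (fun b u => ?_) a x).symm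
  simp [LinearMap.flip_apply]

theorem mulLeft_regular (l : CopDual k A) (x v : CopDual k A ⊗[k] A) :
    (LinearMap.mulLeft k l).rTensor A (regular k A x v) =
      regular k A ((LinearMap.mulLeft k l).rTensor A x) v := by
  induction x with
  | zero => simp
  | add x y hx hy => simp only [map_add, LinearMap.add_apply, hx, hy]
  | tmul m y =>
    rw [LinearMap.rTensor_tmul, regular_tmul, regular_tmul, ← LinearMap.comp_apply,
      ← LinearMap.rTensor_comp, LinearMap.mulLeft_apply, LinearMap.mulLeft_mul]

theorem regular_assoc (x y z : CopDual k A ⊗[k] A) :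
    regular k A (regular k A x y) z = regular k A x (regular k A y z) := by
  induction x with
  | zero => simp
  | add x x' hx hy => simp only [map_add, LinearMap.add_apply, hx, hy]
  | tmul m a => rw [regular_tmul, regular_tmul, act_regular, mulLeft_regular]

theorem counit_antipodeInv (a : A) : counit (R := k) (antipodeInv k A a) = counit a := by
  rw [← counit_antipode (R := k) (antipodeInv k A a), antipode_antipodeInv]

theorem leftShift_one (a : A) : leftShift k A a 1 = counit (R := k) a • 1 := by
  apply CopDual.ext; intro z
  rw [leftShift_apply, map_smul, LinearMap.smul_apply, toDual_one, toDual_one,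
    Bialgebra.counit_mul, smul_eq_mul, counit_antipodeInv]

/-- `y (ν · b) = ν(S⁻¹(y''') ? y') · y'' b`. -/
theorem act_tmul {U : Type*} [AddCommGroup U] [Module k U] (ρ : A →ₐ[k] Module.End k U)
    {ι : Type*} {κ : ι → Type*} {y : A} (r : Coalgebra.Repr k y ι)
    (s : ∀ i, Coalgebra.Repr k (r.right i) (κ i)) (ν : CopDual k A) (u : U) :
    act ρ y (ν ⊗ₜ u) = ∑ i ∈ r.index, ∑ j ∈ (s i).index,
      rightShift k A (r.left i) (leftShift k A ((s i).right j) ν) ⊗ₜ ρ ((s i).left j) u := by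
  rw [act, convAlgHom_apply _ _ _ r, LinearMap.sum_apply]
  refine Finset.sum_congr rfl fun i _ => ?_
  rw [convAlgHom_apply _ _ _ (s i), Finset.mul_sum, LinearMap.sum_apply]
  rfl

theorem act_one {U : Type*} [AddCommGroup U] [Module k U] (ρ : A →ₐ[k] Module.End k U)
    (y : A) (u : U) : act ρ y (1 ⊗ₜ u) = 1 ⊗ₜ ρ y u := by
  suffices Intertwines (TensorProduct.mk k (CopDual k A) U 1) (toConv ρ.toLinearMap)
    (toConv (act ρ).toLinearMap) from (this y u).symm
  rw [act_toConv, ← one_mul (toConv ρ.toLinearMap), ← mul_one (toConv ρ.toLinearMap)]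
  refine .mul ?_ (.mul ?_ ?_) <;> intro a w
  · change (1 : CopDual k A) ⊗ₜ[k] (algebraMap k (Module.End k U) (counit a) w) =
      rightShift k A a 1 ⊗ₜ w
    rw [rightShift_one, Module.algebraMap_end_apply, TensorProduct.smul_tmul]
  · rfl
  · change (1 : CopDual k A) ⊗ₜ[k] (algebraMap k (Module.End k U) (counit a) w) =
      leftShift k A a 1 ⊗ₜ w
    rw [leftShift_one, Module.algebraMap_end_apply, TensorProduct.smul_tmul]

theorem regular_one (x : CopDual k A ⊗[k] A) : regular k A x (1 ⊗ₜ 1) = x := by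
  induction x with
  | zero => simp
  | add x y hx hy => simp only [map_add, LinearMap.add_apply, hx, hy]
  | tmul l y => rw [regular_tmul, act_one]; simp

theorem one_regular (x : CopDual k A ⊗[k] A) : regular k A (1 ⊗ₜ 1) x = x := by
  rw [regular_tmul, map_one, LinearMap.mulLeft_one]
  simp

/-- The bicrossed product on `D(A)`. -/
noncomputable instance : Mul (DrinfeldDouble k A) where
  mul x y := of k A (regular k A ((of k A).symm x) ((of k A).symm y))

theorem mul_def (x y : CopDual k A ⊗[k] A) : of k A x * of k A y = of k A (regular k A x y) := rfl

noncomputable instance : Ring (DrinfeldDouble k A) :=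
  { (inferInstance : AddCommGroup (DrinfeldDouble k A)),
    (inferInstance : Mul (DrinfeldDouble k A)),
    (inferInstance : One (DrinfeldDouble k A)) with
    left_distrib := fun x y z => map_add (regular k A x) y z
    right_distrib := fun x y z => LinearMap.congr_fun (map_add (regular k A) x y) z
    zero_mul := fun x => LinearMap.congr_fun (map_zero (regular k A)) x
    mul_zero := fun x => map_zero (regular k A x)
    mul_assoc := fun x y z => regular_assoc (k := k) (A := A) x y z
    one_mul := fun x => one_regular (k := k) (A := A) x
    mul_one := fun x => regular_one (k := k) (A := A) x }

noncomputable instance : Algebra k (DrinfeldDouble k A) :=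
  Algebra.ofModule
    (fun r x y => LinearMap.congr_fun (map_smul (regular k A) r x) y)
    (fun r x y => map_smul (regular k A x) r y)

variable (k A) in
/-- The inclusion of `A` into `D(A)`. -/
noncomputable def ofA : A →ₐ[k] DrinfeldDouble k A :=
  AlgHom.ofLinearMap ((of k A).toLinearMap ∘ₗ TensorProduct.mk k (CopDual k A) A 1) rfl
    (fun a b => by
      change of k A (1 ⊗ₜ (a * b)) = of k A (regular k A (1 ⊗ₜ a) (1 ⊗ₜ b))
      rw [regular_tmul, act_one, LinearMap.mulLeft_one]
      simp)

variable (k A) in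
/-- The inclusion of `A°` into `D(A)`. -/
noncomputable def ofDual : CopDual k A →ₐ[k] DrinfeldDouble k A :=
  AlgHom.ofLinearMap
    ((of k A).toLinearMap ∘ₗ (TensorProduct.mk k (CopDual k A) A).flip 1) rfl
    (fun l m => by
      change of k A ((l * m) ⊗ₜ 1) = of k A (regular k A (l ⊗ₜ 1) (m ⊗ₜ 1))
      rw [regular_tmul, map_one]
      simp)

theorem ofDual_mul_ofA (l : CopDual k A) (y : A) :
    ofDual k A l * ofA k A y = of k A (l ⊗ₜ y) := by
  change of k A (regular k A (l ⊗ₜ 1) (1 ⊗ₜ y)) = _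
  rw [regular_tmul, map_one]
  simp

theorem ofA_mul (y : A) (v : CopDual k A ⊗[k] A) :
    ofA k A y * of k A v = of k A (act (Algebra.lmul k A) y v) := by
  change of k A (regular k A (1 ⊗ₜ y) v) = _
  rw [regular_tmul, LinearMap.mulLeft_one]
  simp

theorem ofDual_mul (l : CopDual k A) (v : CopDual k A ⊗[k] A) :
    ofDual k A l * of k A v = of k A ((LinearMap.mulLeft k l).rTensor A v) := by
  change of k A (regular k A (l ⊗ₜ 1) v) = _
  rw [regular_tmul, map_one]
  rfl

/-- The commutation relation `y · ν = ν(S⁻¹(y''') ? y') · y''` of the double. -/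
theorem ofA_mul_ofDual {ι : Type*} {κ : ι → Type*} {y : A} (r : Coalgebra.Repr k y ι)
    (s : ∀ i, Coalgebra.Repr k (r.right i) (κ i)) (ν : CopDual k A) :
    ofA k A y * ofDual k A ν = ∑ i ∈ r.index, ∑ j ∈ (s i).index,
      ofDual k A (rightShift k A (r.left i) (leftShift k A ((s i).right j) ν)) *
        ofA k A ((s i).left j) := by
  simp only [ofDual_mul_ofA]
  change ofA k A y * of k A (ν ⊗ₜ 1) = _
  rw [ofA_mul, act_tmul _ r s]
  simp

end DrinfeldDouble
end DrinfeldDouble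

namespace DrinfeldDouble
open WithConv

section Hopf

section Aux

variable {k A : Type*} [Field k] [Ring A] [HopfAlgebra k A]

theorem commute_conv {E : Type*} [Semiring E] [Algebra k E] {f f' : WithConv (A →ₗ[k] E)} {x : E}
    (h : ∀ a, Commute (f a) x) (h' : ∀ a, Commute (f' a) x) (a : A) :
    Commute ((f * f') a) x := by
  rw [(ℛ k a).convMul_apply]
  exact Commute.sum_left _ _ _ fun i _ => (h _).mul_left (h' _)

theorem conv_insert {V W : Type*} [AddCommGroup V] [Module k V] [AddCommGroup W] [Module k W]
    {M : W →ₗ[k] V} {u g : WithConv (A →ₗ[k] Module.End k V)} (hu : Intertwines M 1 u)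
    (h : ∀ a b, Commute (u a) (g b)) (a : A) (w : W) : (u * g) a (M w) = g a (M w) := by
  rw [(ℛ k a).convMul_apply]
  conv_rhs => rw [← sum_counit_smul (R := k) (ℛ k a)]
  rw [LinearMap.sum_apply, map_sum, LinearMap.sum_apply]
  refine Finset.sum_congr rfl fun i _ => ?_
  rw [(h _ _).eq, Module.End.mul_apply, ← hu, map_smul, LinearMap.smul_apply, ← map_smul]
  congr 1
  rw [← map_smul]
  congr 1

theorem conv_congr {V W : Type*} [AddCommGroup V] [Module k V] [AddCommGroup W] [Module k W]
    {M : W →ₗ[k] V} {f g g' : WithConv (A →ₗ[k] Module.End k V)}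
    (h : ∀ a w, g a (M w) = g' a (M w)) (a : A) (w : W) :
    (f * g) a (M w) = (f * g') a (M w) := by
  rw [(ℛ k a).convMul_apply, (ℛ k a).convMul_apply, LinearMap.sum_apply, LinearMap.sum_apply]
  exact Finset.sum_congr rfl fun i _ => by rw [Module.End.mul_apply, Module.End.mul_apply, h]

variable [FiniteDimensional k A]

theorem comul_rightShift (a : A) (l : CopDual k A) :
    comul (R := k) (rightShift k A a l) = (rightShift k A a).rTensor _ (comul l) := by
  apply pair2_ext
  intro x y
  have h (t : CopDual k A ⊗[k] CopDual k A) :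
      pair2 k A ((rightShift k A a).rTensor _ t) (x ⊗ₜ y) = pair2 k A t ((x * a) ⊗ₜ y) := by
    induction t with
    | zero => simp
    | add x y hx hy => simp [hx, hy]
    | tmul x y => simp [pair2_tmul, rightShift_apply]
  rw [h, pair2_comul, pair2_comul, rightShift_apply, mul_assoc]

variable [InvertibleAntipode k A]

theorem comul_leftShift (a : A) (l : CopDual k A) :
    comul (R := k) (leftShift k A a l) = (leftShift k A a).lTensor _ (comul l) := by
  apply pair2_ext
  intro x y
  have h (t : CopDual k A ⊗[k] CopDual k A) :
      pair2 k A ((leftShift k A a).lTensor _ t) (x ⊗ₜ y) =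
        pair2 k A t (x ⊗ₜ (antipodeInv k A a * y)) := by
    induction t with
    | zero => simp
    | add x y hx hy => simp [hx, hy]
    | tmul x y => simp [pair2_tmul, leftShift_apply]
  rw [h, pair2_comul, pair2_comul, leftShift_apply, mul_assoc]

theorem sum_shift_comul {ι : Type*} {a : A} (r : Coalgebra.Repr k a ι) (l : CopDual k A) :
    ∑ i ∈ r.index, TensorProduct.map (leftShift k A (r.left i)) (rightShift k A (r.right i))
      (comul (R := k) l) = counit (R := k) a • comul (R := k) l := by
  apply pair2_ext
  intro x y
  have h (b c : A) (t : CopDual k A ⊗[k] CopDual k A) :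
      pair2 k A (TensorProduct.map (leftShift k A b) (rightShift k A c) t) (x ⊗ₜ y) =
        pair2 k A t ((antipodeInv k A b * x) ⊗ₜ (y * c)) := by
    induction t with
    | zero => simp
    | add x y hx hy => simp [hx, hy]
    | tmul x y => simp [pair2_tmul, leftShift_apply, rightShift_apply]
  simp only [map_sum, LinearMap.sum_apply, h, pair2_comul, map_smul, LinearMap.smul_apply]
  have h2 (b c : A) : y * c * (antipodeInv k A b * x) = y * (c * antipodeInv k A b) * x := by
    simp only [mul_assoc]
  simp only [h2, ← map_sum, ← Finset.sum_mul, ← Finset.mul_sum, sum_mul_antipodeInv]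
  simp

end Aux

variable {k A : Type*} [Field k] [Ring A] [HopfAlgebra k A]

/-- Two linear maps agreeing on rearranged tensors. -/
theorem tensorComm_eq {X : Type*} [AddCommGroup X] [Module k X]
    (f : (CopDual k A ⊗[k] A) ⊗[k] (CopDual k A ⊗[k] A) →ₗ[k] X) (g : (CopDual k A ⊗[k] CopDual k A) ⊗[k] (A ⊗[k] A) →ₗ[k] X)
    (h : ∀ l m a b, f ((l ⊗ₜ a) ⊗ₜ (m ⊗ₜ b)) = g ((l ⊗ₜ m) ⊗ₜ (a ⊗ₜ b)))
    (t : CopDual k A ⊗[k] CopDual k A) (s : A ⊗[k] A) :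
    f (TensorProduct.tensorTensorTensorComm k (CopDual k A) (CopDual k A) A A (t ⊗ₜ s)) =
      g (t ⊗ₜ s) := by
  induction t with
  | zero => simp
  | add x y hx hy => simp only [TensorProduct.add_tmul, map_add, hx, hy]
  | tmul l m =>
    induction s with
    | zero => simp
    | add x y hx hy => simp only [TensorProduct.tmul_add, map_add, hx, hy]
    | tmul a b => exact h l m a b

variable [FiniteDimensional k A]

theorem comul_double_tmul (l : CopDual k A) (b : A) :
    comul (R := k) (l ⊗ₜ[k] b) = TensorProduct.tensorTensorTensorComm k (CopDual k A)
      (CopDual k A) A A (comul (R := k) l ⊗ₜ comul (R := k) b) := rfl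

theorem comul_repR (a : A) (v : CopDual k A ⊗[k] A) :
    comul (R := k) (repR A a v) = (repR A a).rTensor _ (comul (R := k) v) := by
  induction v with
  | zero => simp
  | add x y hx hy => simp only [map_add, hx, hy]
  | tmul l b =>
    rw [repR_tmul, comul_double_tmul, comul_double_tmul, comul_rightShift]
    exact (tensorComm_eq ((repR A a).rTensor _) ((TensorProduct.tensorTensorTensorComm k (CopDual k A)
      (CopDual k A) A A).toLinearMap ∘ₗ
      ((rightShift k A a).rTensor _).rTensor _) (fun l m c d => by simp [repR_tmul]) _ _).symm

theorem comul_repM {ι : Type*} {a : A} (r : Coalgebra.Repr k a ι) (v : CopDual k A ⊗[k] A) :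
    comul (R := k) (repM (Algebra.lmul k A) a v) = ∑ i ∈ r.index,
      TensorProduct.map (repM (Algebra.lmul k A) (r.left i)) (repM (Algebra.lmul k A) (r.right i))
        (comul (R := k) v) := by
  induction v with
  | zero => simp
  | add x y hx hy => simp only [map_add, Finset.sum_add_distrib, hx, hy]
  | tmul l b =>
    rw [repM_tmul, comul_double_tmul, comul_double_tmul]
    rw [← LinearMap.sum_apply]
    refine Eq.trans ?_ (tensorComm_eq (∑ i ∈ r.index,
      TensorProduct.map (repM (Algebra.lmul k A) (r.left i)) (repM (Algebra.lmul k A) (r.right i)))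
      ((TensorProduct.tensorTensorTensorComm k (CopDual k A)
      (CopDual k A) A A).toLinearMap ∘ₗ (LinearMap.mulLeft k (comul (R := k) a)).lTensor _)
      (fun l m c d => ?_) _ _).symm
    · simp
    · rw [← r.eq]
      simp [repM_tmul, Finset.sum_mul, TensorProduct.tmul_sum]

variable [InvertibleAntipode k A]

theorem comul_repL (a : A) (v : CopDual k A ⊗[k] A) :
    comul (R := k) (repL A a v) = (repL A a).lTensor _ (comul (R := k) v) := by
  induction v with
  | zero => simp
  | add x y hx hy => simp only [map_add, hx, hy]
  | tmul l b =>
    rw [repL_tmul, comul_double_tmul, comul_double_tmul, comul_leftShift]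
    exact (tensorComm_eq ((repL A a).lTensor _) ((TensorProduct.tensorTensorTensorComm k (CopDual k A)
      (CopDual k A) A A).toLinearMap ∘ₗ
      ((leftShift k A a).lTensor _).rTensor _) (fun l m c d => by simp [repL_tmul]) _ _).symm

theorem comul_repLR {ι : Type*} {a : A} (r : Coalgebra.Repr k a ι) (v : CopDual k A ⊗[k] A) :
    ∑ i ∈ r.index, TensorProduct.map (repL A (r.left i)) (repR A (r.right i))
        (comul (R := k) v) = counit (R := k) a • comul (R := k) v := by
  induction v with
  | zero => simp
  | add x y hx hy => simp only [map_add, Finset.sum_add_distrib, hx, hy, smul_add]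
  | tmul l b =>
    rw [comul_double_tmul, ← LinearMap.sum_apply]
    refine (tensorComm_eq (∑ i ∈ r.index,
      TensorProduct.map (repL A (r.left i)) (repR A (r.right i)))
      ((TensorProduct.tensorTensorTensorComm k (CopDual k A)
      (CopDual k A) A A).toLinearMap ∘ₗ (∑ i ∈ r.index, TensorProduct.map (leftShift k A (r.left i))
        (rightShift k A (r.right i))).rTensor _)
      (fun l m c d => ?_) _ _).trans ?_
    · simp [repL_tmul, repR_tmul, TensorProduct.sum_tmul]
    · simp only [LinearMap.comp_apply, LinearMap.rTensor_tmul, LinearMap.sum_apply,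
        sum_shift_comul]
      rw [← TensorProduct.smul_tmul', map_smul]
      rfl

theorem comul_act {ι : Type*} {a : A} (r : Coalgebra.Repr k a ι) (v : CopDual k A ⊗[k] A) :
    comul (R := k) (act (Algebra.lmul k A) a v) = ∑ i ∈ r.index,
      TensorProduct.map (act (Algebra.lmul k A) (r.left i)) (act (Algebra.lmul k A) (r.right i))
        (comul (R := k) v) := by
  let one1 := Module.End.rTensorAlgHom k (CopDual k A ⊗[k] A) (CopDual k A ⊗[k] A)
  let one2 := Module.End.lTensorAlgHom k (CopDual k A ⊗[k] A) (CopDual k A ⊗[k] A)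
  let R1 := toConv (one1.toLinearMap ∘ₗ (repR A : A →ₐ[k] _).toLinearMap)
  let R2 := toConv (one2.toLinearMap ∘ₗ (repR A : A →ₐ[k] _).toLinearMap)
  let L1 := toConv (one1.toLinearMap ∘ₗ (repL A : A →ₐ[k] _).toLinearMap)
  let L2 := toConv (one2.toLinearMap ∘ₗ (repL A : A →ₐ[k] _).toLinearMap)
  let M1 := toConv (one1.toLinearMap ∘ₗ (repM (Algebra.lmul k A)).toLinearMap)
  let M2 := toConv (one2.toLinearMap ∘ₗ (repM (Algebra.lmul k A)).toLinearMap)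
  have hmap (f g : Module.End k (CopDual k A ⊗[k] A)) : one1 f * one2 g = TensorProduct.map f g :=
    LinearMap.rTensor_comp_lTensor _ _ _
  have hcomm (f g : Module.End k (CopDual k A ⊗[k] A)) : Commute (one1 f) (one2 g) :=
    (LinearMap.rTensor_comp_lTensor _ _ _).trans (LinearMap.lTensor_comp_rTensor _ _ _).symm
  have h1 : toConv (one1.toLinearMap ∘ₗ (act (Algebra.lmul k A)).toLinearMap) =
      R1 * (M1 * L1) := by
    have h3 : (act (Algebra.lmul k A)).toLinearMap =
      (toConv (act (Algebra.lmul k A)).toLinearMap).ofConv := rfl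
    rw [h3, act_toConv, LinearMap.algHom_comp_convMul_distrib,
      LinearMap.algHom_comp_convMul_distrib]
  have h2 : toConv (one2.toLinearMap ∘ₗ (act (Algebra.lmul k A)).toLinearMap) =
      R2 * (M2 * L2) := by
    have h3 : (act (Algebra.lmul k A)).toLinearMap =
      (toConv (act (Algebra.lmul k A)).toLinearMap).ofConv := rfl
    rw [h3, act_toConv, LinearMap.algHom_comp_convMul_distrib,
      LinearMap.algHom_comp_convMul_distrib]
  have hR : Intertwines (comul (R := k) (A := CopDual k A ⊗[k] A)) (toConv (repR A).toLinearMap) R1 :=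
    fun a w => comul_repR a w
  have hL : Intertwines (comul (R := k) (A := CopDual k A ⊗[k] A)) (toConv (repL A).toLinearMap) L2 :=
    fun a w => comul_repL a w
  have hM : Intertwines (comul (R := k) (A := CopDual k A ⊗[k] A)) (toConv (repM (Algebra.lmul k A)).toLinearMap)
      (M1 * M2) := by
    intro a w
    rw [(ℛ k a).convMul_apply, LinearMap.sum_apply]
    refine (comul_repM (ℛ k a) w).trans (Finset.sum_congr rfl fun i _ => ?_)
    rw [← hmap]; rfl
  have hu : Intertwines (comul (R := k) (A := CopDual k A ⊗[k] A)) 1 (L1 * R2) := by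
    intro a w
    rw [(ℛ k a).convMul_apply, LinearMap.sum_apply]
    refine Eq.trans ?_ ((comul_repLR (ℛ k a) w).symm.trans (Finset.sum_congr rfl fun i _ => ?_))
    · rw [← map_smul]; rfl
    · rw [← hmap]; rfl
  have hc : ∀ a b, Commute ((L1 * R2) a) ((M2 * L2) b) := by
    intro a b
    refine commute_conv (fun a => ?_) (fun a => ?_) a <;>
    refine (commute_conv (fun b => ?_) (fun b => ?_) b).symm
    · exact (hcomm _ _).symm
    · exact (hcomm _ _).symm
    · exact ((commute_RM (Algebra.lmul k A) a b).map one2).symm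
    · exact ((commute_RL a b).map one2).symm
  have key : ∀ a w, (toConv (one1.toLinearMap ∘ₗ (act (Algebra.lmul k A)).toLinearMap) *
      toConv (one2.toLinearMap ∘ₗ (act (Algebra.lmul k A)).toLinearMap)) a
        (comul (R := k) (A := CopDual k A ⊗[k] A) w) = comul (R := k) (act (Algebra.lmul k A) a w) := by
    intro a w
    have h4 := (hR.mul (hM.mul hL)) a w
    rw [← act_toConv] at h4
    refine Eq.trans ?_ h4.symm
    have e1 : R1 * (M1 * L1) * (R2 * (M2 * L2)) = R1 * (M1 * ((L1 * R2) * (M2 * L2))) := by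
      simp only [mul_assoc]
    rw [h1, h2, e1, mul_assoc M1]
    exact conv_congr (conv_congr (conv_insert hu hc)) a w
  rw [← key a v, r.convMul_apply, LinearMap.sum_apply]
  refine Finset.sum_congr rfl fun i _ => ?_
  rw [← hmap]; rfl

end Hopf
end DrinfeldDouble

namespace DrinfeldDouble
open WithConv

section Hopf2

variable {k A : Type*} [Field k] [Ring A] [HopfAlgebra k A]

theorem ind {P : DrinfeldDouble k A → Prop} (h0 : P 0) (hadd : ∀ x y, P x → P y → P (x + y))
    (h : ∀ l y, P (of k A (l ⊗ₜ y))) (x : DrinfeldDouble k A) : P x := by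
  obtain ⟨w, rfl⟩ := (of k A).surjective x
  induction w with
  | zero => rwa [map_zero]
  | add x y hx hy => rw [map_add]; exact hadd _ _ hx hy
  | tmul l y => exact h l y

variable [FiniteDimensional k A]

theorem counit_of (l : CopDual k A) (y : A) :
    counit (R := k) (of k A (l ⊗ₜ y)) = counit (R := k) y * counit (R := k) l := rfl

theorem comul_of (w : CopDual k A ⊗[k] A) : comul (R := k) (of k A w) =
    TensorProduct.map (of k A).toLinearMap (of k A).toLinearMap (comul (R := k) w) :=
  (LinearMap.congr_fun (TensorProduct.map_id (R := k) (M := CopDual k A ⊗[k] A)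
    (N := CopDual k A ⊗[k] A)) (comul (R := k) w)).symm

variable [InvertibleAntipode k A]

theorem comul_ofA_mul (y : A) (v : DrinfeldDouble k A) :
    comul (R := k) (ofA k A y * v) =
      TensorProduct.map (ofA k A).toLinearMap (ofA k A).toLinearMap (comul (R := k) y) *
        comul (R := k) v := by
  obtain ⟨w, rfl⟩ := (of k A).surjective v
  rw [ofA_mul, comul_of, comul_of, comul_act (ℛ k y), ← (ℛ k y).eq, map_sum, map_sum,
    Finset.sum_mul]
  refine Finset.sum_congr rfl fun i _ => ?_
  generalize comul (R := k) w = t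
  induction t with
  | zero => simp
  | add x y hx hy => simp only [map_add, mul_add, hx, hy]
  | tmul x y => simp [Algebra.TensorProduct.tmul_mul_tmul, ofA_mul]

theorem comul_ofDual_mul (l : CopDual k A) (v : DrinfeldDouble k A) :
    comul (R := k) (ofDual k A l * v) =
      TensorProduct.map (ofDual k A).toLinearMap (ofDual k A).toLinearMap (comul (R := k) l) *
        comul (R := k) v := by
  induction v using ind with
  | h0 => simp
  | hadd x y hx hy => simp only [map_add, mul_add, hx, hy]
  | h m b =>
    rw [ofDual_mul, LinearMap.rTensor_tmul, LinearMap.mulLeft_apply, comul_of, comul_of,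
      comul_double_tmul, comul_double_tmul, Bialgebra.comul_mul]
    generalize comul (R := k) l = t
    induction t with
    | zero => simp
    | add x y hx hy => simp only [map_add, add_mul, TensorProduct.add_tmul, hx, hy]
    | tmul l1 l2 =>
      refine (tensorComm_eq ((LinearMap.mulLeft k (ofDual k A l1 ⊗ₜ[k] ofDual k A l2)) ∘ₗ
        TensorProduct.map (of k A).toLinearMap (of k A).toLinearMap)
        (TensorProduct.map (of k A).toLinearMap (of k A).toLinearMap ∘ₗ
          (TensorProduct.tensorTensorTensorComm k (CopDual k A) (CopDual k A) A A).toLinearMap ∘ₗ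
          (LinearMap.mulLeft k (l1 ⊗ₜ[k] l2)).rTensor _) (fun p q a c => ?_)
          (comul (R := k) m) (comul (R := k) b)).symm
      simp [Algebra.TensorProduct.tmul_mul_tmul, ofDual_mul]

theorem comul_ofA (y : A) : comul (R := k) (ofA k A y) =
    TensorProduct.map (ofA k A).toLinearMap (ofA k A).toLinearMap (comul (R := k) y) := by
  rw [← mul_one (ofA k A y), comul_ofA_mul]
  have h : comul (R := k) (1 : DrinfeldDouble k A) = 1 := by
    change TensorProduct.tensorTensorTensorComm k (CopDual k A) (CopDual k A) A A
      (comul (R := k) (1 : CopDual k A) ⊗ₜ comul (R := k) (1 : A)) = _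
    rw [Bialgebra.comul_one, Bialgebra.comul_one]
    rfl
  rw [h, mul_one]

theorem comul_mul_double (x y : DrinfeldDouble k A) :
    comul (R := k) (x * y) = comul (R := k) x * comul (R := k) y := by
  induction x using ind with
  | h0 => simp
  | hadd x x' hx hy => simp only [map_add, add_mul, hx, hy]
  | h l a =>
    rw [← ofDual_mul_ofA, mul_assoc, comul_ofDual_mul, comul_ofA_mul, comul_ofDual_mul,
      comul_ofA, mul_assoc]

theorem counit_ofA_mul (a : A) (v : DrinfeldDouble k A) :
    counit (R := k) (ofA k A a * v) = counit (R := k) a * counit (R := k) v := by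
  -- the trivial representation of `A`
  let triv : A →ₐ[k] Module.End k k := (Algebra.ofId k _).comp (Bialgebra.counitAlgHom k A)
  let e : CopDual k A ⊗[k] k →ₗ[k] k :=
    LinearMap.mul' k k ∘ₗ (dualCounit k A).rTensor k
  have he : ∀ w : CopDual k A ⊗[k] A, counit (R := k) (of k A w) =
      e ((counit (R := k) (A := A)).lTensor _ w) := by
    intro w
    induction w with
    | zero => simp
    | add x y hx hy => simp only [map_add, hx, hy]
    | tmul x y => 
      rw [counit_of, mul_comm]
      change _ = dualCounit k A x * counit (R := k) y
      rfl
  have hM : toConv (repM triv).toLinearMap = 1 := by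
    ext a : 2
    refine TensorProduct.ext' fun l u => ?_
    change l ⊗ₜ[k] (algebraMap k (Module.End k k) (counit a) u) =
      algebraMap k (Module.End k (CopDual k A ⊗[k] k)) (counit a) (l ⊗ₜ u)
    rw [Module.algebraMap_end_apply, Module.algebraMap_end_apply, TensorProduct.tmul_smul]
  obtain ⟨w, rfl⟩ := (of k A).surjective v
  rw [ofA_mul, he, he, act_natural _ triv _ (fun b u => by
    simp [triv, Algebra.ofId_apply, Module.algebraMap_end_apply]) a w]
  generalize (counit (R := k) (A := A)).lTensor _ w = z
  have h5 : toConv (act triv).toLinearMap =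
      toConv (repR k).toLinearMap * toConv (repL k).toLinearMap := by
    rw [act_toConv, hM, one_mul]
  have h8 : act triv a = ∑ i ∈ (ℛ k a).index,
      repR k ((ℛ k a).left i) * repL k ((ℛ k a).right i) := by
    have h9 := congrArg (fun f => f.ofConv a) h5
    rw [(ℛ k a).convMul_apply] at h9
    exact h9
  rw [h8, LinearMap.sum_apply, map_sum]
  induction z with
  | zero => simp
  | add x y hx hy => simp only [map_add, Finset.sum_add_distrib, hx, hy, mul_add]
  | tmul l c =>
    have h6 (b d : A) : e (repR k b (repL k d (l ⊗ₜ c))) =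
        toDual k A l (antipodeInv k A d * b) * c := by
      rw [repL_tmul, repR_tmul]
      change dualCounit k A _ * c = _
      rw [dualCounit_apply, rightShift_apply, leftShift_apply, one_mul]
    have h7 : e (l ⊗ₜ c) = toDual k A l 1 * c := rfl
    rw [h7]
    simp only [Module.End.mul_apply, h6, ← Finset.sum_mul, ← map_sum, sum_antipodeInv_mul]
    rw [map_smul, smul_eq_mul, mul_assoc]

theorem counit_mul_double (x y : DrinfeldDouble k A) :
    counit (R := k) (x * y) = counit (R := k) x * counit (R := k) y := by
  induction x using ind with
  | h0 => simp
  | hadd x x' hx hy => simp only [map_add, add_mul, hx, hy]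
  | h l a =>
    rw [← ofDual_mul_ofA, mul_assoc, ofDual_mul_ofA, counit_of, mul_comm (counit a), mul_assoc,
      ← counit_ofA_mul]
    generalize ofA k A a * y = z
    obtain ⟨w, rfl⟩ := (of k A).surjective z
    rw [ofDual_mul]
    induction w with
    | zero => simp
    | add x y hx hy => simp only [map_add, hx, hy, mul_add]
    | tmul m b =>
      rw [LinearMap.rTensor_tmul, counit_of, counit_of, LinearMap.mulLeft_apply,
        Bialgebra.counit_mul]
      ring

noncomputable instance : Bialgebra k (DrinfeldDouble k A) :=
  Bialgebra.mk' k (DrinfeldDouble k A)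
    ((counit_of 1 1).trans (by rw [Bialgebra.counit_one, Bialgebra.counit_one, mul_one]))
    (fun {x y} => counit_mul_double x y)
    (by
      have h := comul_ofA (k := k) (1 : A)
      rw [map_one, Bialgebra.comul_one, Algebra.TensorProduct.one_def] at h
      simpa [Algebra.TensorProduct.one_def] using h)
    (fun {x y} => comul_mul_double x y)

variable (k A) in
/-- The antipode of `D(A)`: `S(λ · y) = S(y) · S(λ)`. -/
noncomputable def doubleAntipode : DrinfeldDouble k A →ₗ[k] DrinfeldDouble k A :=
  LinearMap.mul' k (DrinfeldDouble k A) ∘ₗ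
    TensorProduct.map ((ofA k A).toLinearMap ∘ₗ antipode k)
      ((ofDual k A).toLinearMap ∘ₗ antipode k) ∘ₗ
    (TensorProduct.comm k (CopDual k A) A).toLinearMap ∘ₗ (of k A).symm.toLinearMap

theorem doubleAntipode_of (l : CopDual k A) (y : A) :
    doubleAntipode k A (of k A (l ⊗ₜ y)) =
      ofA k A (antipode k y) * ofDual k A (antipode k l) := by
  simp [doubleAntipode]

/-- The representation of the coproduct of `λ · y`. -/
noncomputable def reprOf {ι κ : Type*} {l : CopDual k A} {y : A} (r : Coalgebra.Repr k l ι)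
    (s : Coalgebra.Repr k y κ) : Coalgebra.Repr k (of k A (l ⊗ₜ y)) (ι × κ) where
  index := r.index ×ˢ s.index
  left i := of k A (r.left i.1 ⊗ₜ s.left i.2)
  right i := of k A (r.right i.1 ⊗ₜ s.right i.2)
  eq := (r.tmul s).eq

/-- The Drinfeld double is a Hopf algebra. -/
noncomputable instance : HopfAlgebra k (DrinfeldDouble k A) where
  antipode := doubleAntipode k A
  mul_antipode_rTensor_comul := by
    refine LinearMap.ext fun x => ?_
    obtain ⟨w, rfl⟩ := (of k A).surjective x
    induction w with
    | zero => simp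
    | add x y hx hy => rw [map_add, map_add, hx, hy, map_add]
    | tmul l y =>
      rw [LinearMap.comp_apply, LinearMap.comp_apply, ← (reprOf (ℛ k l) (ℛ k y)).eq]
      simp only [map_sum, reprOf, LinearMap.rTensor_tmul, LinearMap.mul'_apply, doubleAntipode_of,
        Finset.sum_product, LinearMap.comp_apply]
      have h (a b : A) (p q : CopDual k A) :
          ofA k A (antipode k a) * ofDual k A (antipode k p) * of k A (q ⊗ₜ b) =
          ofA k A (antipode k a) * ofDual k A (antipode k p * q) * ofA k A b := by
        rw [← ofDual_mul_ofA, map_mul]; simp only [mul_assoc]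
      simp only [h]
      rw [Finset.sum_comm]
      simp only [← Finset.sum_mul, ← Finset.mul_sum, ← map_sum, sum_antipode_mul_eq_smul]
      simp only [map_smul, map_one, mul_smul_comm, smul_mul_assoc, mul_one, ← map_mul,
        ← Finset.smul_sum, ← map_sum, sum_antipode_mul_eq_smul]
      rw [counit_of, Algebra.linearMap_apply, Algebra.algebraMap_eq_smul_one, smul_smul,
        mul_comm]
  mul_antipode_lTensor_comul := by
    refine LinearMap.ext fun x => ?_
    obtain ⟨w, rfl⟩ := (of k A).surjective x
    induction w with
    | zero => simp
    | add x y hx hy => rw [map_add, map_add, hx, hy, map_add]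
    | tmul l y =>
      rw [LinearMap.comp_apply, LinearMap.comp_apply, ← (reprOf (ℛ k l) (ℛ k y)).eq]
      simp only [map_sum, reprOf, LinearMap.lTensor_tmul, LinearMap.mul'_apply, doubleAntipode_of,
        Finset.sum_product, LinearMap.comp_apply]
      have h (a b : A) (p q : CopDual k A) :
          of k A (p ⊗ₜ a) * (ofA k A (antipode k b) * ofDual k A (antipode k q)) =
          ofDual k A p * ofA k A (a * antipode k b) * ofDual k A (antipode k q) := by
        rw [← ofDual_mul_ofA, map_mul]; simp only [mul_assoc]
      simp only [h]
      simp only [← Finset.sum_mul, ← Finset.mul_sum, ← map_sum, sum_mul_antipode_eq_smul]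
      simp only [map_smul, map_one, mul_smul_comm, smul_mul_assoc, mul_one, ← map_mul,
        ← Finset.smul_sum, ← map_sum, sum_mul_antipode_eq_smul]
      rw [counit_of, Algebra.linearMap_apply, Algebra.algebraMap_eq_smul_one, smul_smul]

theorem antipode_of (l : CopDual k A) (y : A) :
    antipode k (of k A (l ⊗ₜ y)) = ofA k A (antipode k y) * ofDual k A (antipode k l) :=
  doubleAntipode_of l y

theorem antipode_ofA (y : A) : antipode k (ofA k A y) = ofA k A (antipode k y) := by
  refine (antipode_of (1 : CopDual k A) y).trans ?_
  rw [antipode_one, map_one, mul_one]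

theorem antipode_ofDual (l : CopDual k A) :
    antipode k (ofDual k A l) = ofDual k A (antipode k l) := by
  refine (antipode_of l (1 : A)).trans ?_
  rw [antipode_one, map_one, one_mul]

theorem antipode_dual_surjective :
    Function.Surjective (antipode k (A := CopDual k A)) := by
  intro l
  refine ⟨(toDual k A).symm ((antipode k (A := A)).dualMap (toDual k A l)), ?_⟩
  apply CopDual.ext
  intro a
  refine (toDual_dualAntipode _ a).trans ?_
  simp [antipode_antipodeInv]

variable (k A) in
/-- The multiplication map `A ⊗ A° → D(A)`, `y ⊗ λ ↦ y · λ`. -/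
noncomputable def mulMap : A ⊗[k] CopDual k A →ₗ[k] DrinfeldDouble k A :=
  LinearMap.mul' k (DrinfeldDouble k A) ∘ₗ
    TensorProduct.map (ofA k A).toLinearMap (ofDual k A).toLinearMap

instance : FiniteDimensional k (CopDual k A) := Module.Finite.equiv (toDual k A).symm

theorem mulMap_bijective : Function.Bijective (mulMap k A) := by
  have hs : Function.Surjective (mulMap k A) := by
    intro x
    have hS : Function.Surjective (antipode k (A := DrinfeldDouble k A)) := by
      intro x
      obtain ⟨w, rfl⟩ := (of k A).surjective x
      induction w with
      | zero => exact ⟨0, by simp⟩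
      | add x y hx hy =>
        obtain ⟨a, ha⟩ := hx
        obtain ⟨b, hb⟩ := hy
        exact ⟨a + b, by rw [map_add, map_add, ha, hb]⟩
      | tmul l y =>
        obtain ⟨m, rfl⟩ := antipode_dual_surjective (k := k) l
        refine ⟨ofA k A (antipodeInv k A y) * ofDual k A m, ?_⟩
        rw [antipode_mul_antidistrib, antipode_ofA, antipode_ofDual, antipode_antipodeInv,
          ofDual_mul_ofA]
    obtain ⟨z, rfl⟩ := hS x
    obtain ⟨w, rfl⟩ := (of k A).surjective z
    induction w with
    | zero => exact ⟨0, by simp⟩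
    | add x y hx hy =>
      obtain ⟨a, ha⟩ := hx
      obtain ⟨b, hb⟩ := hy
      exact ⟨a + b, by rw [map_add, ha, hb, ← map_add, ← map_add]⟩
    | tmul l y =>
      exact ⟨antipode k y ⊗ₜ antipode k l, by rw [antipode_of]; simp [mulMap]⟩
  refine ⟨?_, hs⟩
  have hf := (TensorProduct.comm k A (CopDual k A) ≪≫ₗ of k A)
  have : FiniteDimensional k (DrinfeldDouble k A) := Module.Finite.equiv hf
  exact (LinearMap.injective_iff_surjective_of_finrank_eq_finrank hf.finrank_eq).2 hs

variable (k A) in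
/-- The identification `D(A) ≅ A ⊗ A° = End(A)`, inverse to
`y ⊗ λ ↦ y · λ`, where `y ⊗ λ` acts on `A` as `z ↦ ⟨λ, z⟩ y`. -/
noncomputable def toEnd : DrinfeldDouble k A ≃ₗ[k] Module.End k A :=
  (LinearEquiv.ofBijective (mulMap k A) mulMap_bijective).symm ≪≫ₗ
    TensorProduct.comm k A (CopDual k A) ≪≫ₗ
    TensorProduct.congr (toDual k A) (LinearEquiv.refl k A) ≪≫ₗ
    dualTensorHomEquiv k A A

theorem toEnd_mul (y : A) (l : CopDual k A) (z : A) :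
    toEnd k A (ofA k A y * ofDual k A l) z = toDual k A l z • y := by
  have h : ofA k A y * ofDual k A l =
      LinearEquiv.ofBijective (mulMap k A) mulMap_bijective (y ⊗ₜ l) := by simp [mulMap]
  simp only [toEnd, LinearEquiv.trans_apply, h, LinearEquiv.symm_apply_apply]
  simp

end Hopf2
end DrinfeldDouble

section Integrals

open DrinfeldDouble

variable (k H : Type*) [Field k] [Ring H] [HopfAlgebra k H]

/-- The space of left cointegrals: `h x = ε(h) x` for all `h`. -/
def leftCointegrals : Submodule k H where
  carrier := {x | ∀ h : H, h * x = counit (R := k) h • x}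
  add_mem' := fun hx hy h => by rw [mul_add, hx h, hy h, smul_add]
  zero_mem' := fun h => by rw [mul_zero, smul_zero]
  smul_mem' := fun c x hx h => by rw [mul_smul_comm, hx h, smul_comm]

/-- The space of right cointegrals: `x h = ε(h) x` for all `h`. -/
def rightCointegrals : Submodule k H where
  carrier := {x | ∀ h : H, x * h = counit (R := k) h • x}
  add_mem' := fun hx hy h => by rw [add_mul, hx h, hy h, smul_add]
  zero_mem' := fun h => by rw [zero_mul, smul_zero]
  smul_mem' := fun c x hx h => by rw [smul_mul_assoc, hx h, smul_comm]

/-- `μ` is a left integral: `(1 ⊗ μ) Δ(h) = μ(h) 1` for all `h`. -/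
def IsLeftIntegral (μ : Module.Dual k H) : Prop :=
  ∀ h : H, TensorProduct.rid k H (μ.lTensor H (comul h)) = μ h • (1 : H)

/-- The character `α` of `H` is the modulus of `H`: `x h = α(h) x` for every left cointegral `x`
and all `h`. -/
def IsModulus (α : H →ₐ[k] k) : Prop :=
  ∀ x ∈ leftCointegrals k H, ∀ h : H, x * h = α h • x

variable (A : Type*) [Ring A] [HopfAlgebra k A] [FiniteDimensional k A]

/-- The composition
`A → A ⊗ A° ⊗ A → A ⊗ A ⊗ A° → A ⊗ A° → A ⊗ A ⊗ A° → A ⊗ A° ⊗ A → A ⊗ A° ⊗ A → A`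
of `R ⊗ 1`, `1 ⊗ τ`, `· ⊗ 1`, `Δ ⊗ 1`, `1 ⊗ τ`, `1 ⊗ 1 ⊗ S²` and `1 ⊗ ⟨ , ⟩`, where
`R = ∑ eᵢ ⊗ fᵢ` is the canonical element of `A ⊗ A°`. -/
noncomputable def projectorFormula : A →ₗ[k] A :=
  let D := Module.Dual k A
  -- `1 ⊗ ⟨ , ⟩`
  (TensorProduct.rid k A).toLinearMap ∘ₗ (contractLeft k A).lTensor A ∘ₗ
  -- `1 ⊗ 1 ⊗ S²`
  ((antipode k ∘ₗ antipode k).lTensor D).lTensor A ∘ₗ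
  -- `1 ⊗ τ`
  (TensorProduct.comm k A D).toLinearMap.lTensor A ∘ₗ
  -- `Δ ⊗ 1`
  (TensorProduct.assoc k A A D).toLinearMap ∘ₗ (comul (R := k) (A := A)).rTensor D ∘ₗ
  -- `· ⊗ 1`
  (LinearMap.mul' k A).rTensor D ∘ₗ (TensorProduct.assoc k A A D).symm.toLinearMap ∘ₗ
  -- `1 ⊗ τ`
  (TensorProduct.comm k D A).toLinearMap.lTensor A ∘ₗ
  -- `R ⊗ 1`
  (TensorProduct.assoc k A D A).toLinearMap ∘ₗ (coevaluation k A).rTensor A ∘ₗ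
    (TensorProduct.lid k A).symm.toLinearMap

variable [InvertibleAntipode k A]

/-- The element `p = μ · S⁻¹(x)` of `D(A)`. -/
noncomputable def canonicalElement (μ : Module.Dual k A) (x : A) : DrinfeldDouble k A :=
  ofDual k A ((toDual k A).symm μ) * ofA k A (antipodeInv k A x)

end Integrals

end HopfDouble

/-! Write Δ(a) = a' ⊗ a'', t = S⁻¹(x) and ν = μ ∘ S⁻¹, so that p = μ·t and S(p) = x·ν. Everything
rests on one identity for a left cointegral x: x' ⊗ h x'' = S(h) x' ⊗ x''. Slicing it with the left
integral gives x' μ(h x'') = μ(x) S(h) (`slice_mulLeft_comul`). With μ(x) = 1 and S bijective, h ↦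
μ(h ?) is an isomorphism of A onto A*, and the slices f ↦ x' f(x'') are an isomorphism of A* onto A.
Hence left cointegrals and left integrals are unique up to scalars; the existence of the normalized
pair (μ, x) is all that is used.

Left invariance of p. Under A° it is the defining property of μ. Under A, the relation y·μ =
μ(S⁻¹(y''') ? y')·y'' produces the factor y'' t = α(S(y'')) t, where α is the modulus of A; the
twisted invariance α(h') μ(z S(h'')) = μ(S⁻¹(h) z) cancels this factor (`sum_modulus_integral`,
`sum_shift_integral`, `ofA_mul_canonicalElement`).

S(p) = p. Applying S to the invariance under A shows that every slice of S(p) along A° is a right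
cointegral of A, hence a multiple of t. The multiple is identified by applying ν: the slice at z
gives μ(S⁻²(z)), which is a fixed nonzero scalar times μ(z) (`integral_evalDual`,
`antipode_canonicalElement`). Then S carries left invariance of p to right invariance. Since D(A)
has the left integral λ·y ↦ λ(t) μ(y), with value 1 on p, uniqueness holds in D(A) too and every
left cointegral is a multiple of the two-sided p, so D(A) is unimodular.

The projector. As p = S(p) = x·ν, the endomorphism is P(z) = ν(z) x, and ν(x) = 1 makes it a
projector onto kx. The closed formula gives the same map, because ∑ eᵢy ⊗ fᵢ = x' ⊗ ν(S(x'') ? y)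
and S(a'') S²(a') = S(S(a') a'') = ε(a) 1. -/

namespace HopfDouble
open Coalgebra HopfAlgebra WithConv DrinfeldDouble

/-! ### Integrals and cointegrals of a finite-dimensional Hopf algebra -/

section Integrals

variable {k H : Type*} [Field k] [Ring H] [HopfAlgebra k H]

variable (k H) in
/-- The slice map `a ⊗ b ↦ f(b) a`. -/
noncomputable def slice (f : Module.Dual k H) : H ⊗[k] H →ₗ[k] H :=
  (TensorProduct.rid k H).toLinearMap ∘ₗ f.lTensor H

@[simp] theorem slice_tmul (f : Module.Dual k H) (a b : H) : slice k H f (a ⊗ₜ b) = f b • a := by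
  simp [slice]

theorem slice_repr (f : Module.Dual k H) {ι : Type*} {a : H} (r : Coalgebra.Repr k a ι) :
    slice k H f (comul a) = ∑ i ∈ r.index, f (r.right i) • r.left i := by
  rw [← r.eq, map_sum]; simp

theorem slice_counit (a : H) : slice k H counit (comul a) = a := by
  simp [slice]

theorem IsLeftIntegral.slice_comul {m : Module.Dual k H} (hm : IsLeftIntegral k H m) (h : H) :
    slice k H m (comul h) = m h • 1 := hm h

/-- Δ becomes a product in the convolution algebra of maps H → H ⊗ H. Identities with iterated
coproducts then reduce to associativity and cancellation of an algebra map against its composite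
with S. -/
theorem toConv_comul : toConv (comul (R := k) (A := H)) =
    toConv (Algebra.TensorProduct.includeLeft : H →ₐ[k] H ⊗[k] H).toLinearMap *
      toConv (Algebra.TensorProduct.includeRight : H →ₐ[k] H ⊗[k] H).toLinearMap := by
  ext a
  rw [(ℛ k a).convMul_apply]
  simp [(ℛ k a).eq]

theorem toConv_antipode_mul {E : Type*} [Ring E] [Algebra k E] (i : H →ₐ[k] E) :
    toConv (i.toLinearMap ∘ₗ antipode k) * toConv i.toLinearMap = 1 := by
  have h := LinearMap.algHom_comp_convMul_distrib i (toConv (antipode k (A := H)))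
    (toConv LinearMap.id)
  rw [LinearMap.antipode_mul_id] at h
  refine WithConv.ext (h.symm.trans ?_)
  ext a
  simp

theorem toConv_mul_antipode {E : Type*} [Ring E] [Algebra k E] (i : H →ₐ[k] E) :
    toConv i.toLinearMap * toConv (i.toLinearMap ∘ₗ antipode k) = 1 := by
  have h := LinearMap.algHom_comp_convMul_distrib i (toConv LinearMap.id)
    (toConv (antipode k (A := H)))
  rw [LinearMap.id_mul_antipode] at h
  refine WithConv.ext (h.symm.trans ?_)
  ext a
  simp

theorem sum_antipode_tmul_one_mul_comul {ι : Type*} {h : H} (r : Coalgebra.Repr k h ι) :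
    ∑ i ∈ r.index, (antipode k (r.left i) ⊗ₜ[k] (1 : H)) * comul (R := k) (r.right i) =
      (1 : H) ⊗ₜ h := by
  have e : toConv ((Algebra.TensorProduct.includeLeft : H →ₐ[k] H ⊗[k] H).toLinearMap ∘ₗ
      antipode k) * toConv (comul (R := k) (A := H)) =
      toConv (Algebra.TensorProduct.includeRight : H →ₐ[k] H ⊗[k] H).toLinearMap := by
    rw [toConv_comul, ← mul_assoc, toConv_antipode_mul, one_mul]
  have e' := congrArg (fun f => f.ofConv h) e
  simp only at e'
  rw [r.convMul_apply] at e'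
  simpa using e'

theorem sum_comul_mul_one_tmul_antipode {ι : Type*} {h : H} (r : Coalgebra.Repr k h ι) :
    ∑ i ∈ r.index, comul (R := k) (r.left i) * ((1 : H) ⊗ₜ[k] antipode k (r.right i)) =
      h ⊗ₜ (1 : H) := by
  have e : toConv (comul (R := k) (A := H)) *
      toConv ((Algebra.TensorProduct.includeRight : H →ₐ[k] H ⊗[k] H).toLinearMap ∘ₗ
      antipode k)  =
      toConv (Algebra.TensorProduct.includeLeft : H →ₐ[k] H ⊗[k] H).toLinearMap := by
    rw [toConv_comul, mul_assoc, toConv_mul_antipode, mul_one]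
  have e' := congrArg (fun f => f.ofConv h) e
  simp only at e'
  rw [r.convMul_apply] at e'
  simpa using e'

/-- `x' ⊗ h x'' = S(h) x' ⊗ x''` for a left cointegral `x`. -/
theorem one_tmul_mul_comul {x : H} (hx : x ∈ leftCointegrals k H) (h : H) :
    ((1 : H) ⊗ₜ[k] h) * comul (R := k) x = (antipode k h ⊗ₜ 1) * comul (R := k) x := by
  -- With 1 ⊗ h = (S(h') ⊗ 1) Δ(h''), the cointegral property turns Δ(h'') Δ(x) = Δ(h'' x) into
  -- ε(h'') Δ(x), and the counit restores S(h) ⊗ 1.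
  rw [← sum_antipode_tmul_one_mul_comul (ℛ k h), Finset.sum_mul]
  simp only [mul_assoc, ← Bialgebra.comul_mul, hx _, map_smul, mul_smul_comm]
  conv_rhs => rw [← slice_counit (k := k) h, slice_repr _ (ℛ k h)]
  simp only [map_sum, map_smul, TensorProduct.sum_tmul, Finset.sum_mul, ← TensorProduct.smul_tmul',
    smul_mul_assoc]

/-- `r' h ⊗ r'' = χ(h') r' ⊗ r'' S(h'')` if `r h = χ(h) r` for all `h`. -/
theorem comul_mul_tmul_one {r : H} {χ : H →ₗ[k] k} (hr : ∀ h, r * h = χ h • r) {ι : Type*} {h : H}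
    (s : Coalgebra.Repr k h ι) : comul (R := k) r * (h ⊗ₜ[k] (1 : H)) =
      ∑ i ∈ s.index, χ (s.left i) • (comul (R := k) r * ((1 : H) ⊗ₜ antipode k (s.right i))) := by
  -- Dually, h ⊗ 1 = Δ(h') (1 ⊗ S(h'')), and Δ(r) absorbs Δ(h') at the cost of χ(h').
  rw [← sum_comul_mul_one_tmul_antipode s, Finset.mul_sum]
  simp only [← mul_assoc, ← Bialgebra.comul_mul, hr, map_smul, smul_mul_assoc]

theorem slice_one_tmul_mul (f : Module.Dual k H) (h : H) (w : H ⊗[k] H) :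
    slice k H f (((1 : H) ⊗ₜ[k] h) * w) = slice k H (f ∘ₗ LinearMap.mulLeft k h) w := by
  induction w with
  | zero => simp
  | add x y hx hy => simp only [mul_add, map_add, hx, hy]
  | tmul a b => simp

theorem slice_mul_one_tmul (f : Module.Dual k H) (h : H) (w : H ⊗[k] H) :
    slice k H f (w * ((1 : H) ⊗ₜ[k] h)) = slice k H (f ∘ₗ LinearMap.mulRight k h) w := by
  induction w with
  | zero => simp
  | add x y hx hy => simp only [add_mul, map_add, hx, hy]
  | tmul a b => simp

theorem slice_tmul_one_mul (f : Module.Dual k H) (h : H) (w : H ⊗[k] H) :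
    slice k H f ((h ⊗ₜ[k] (1 : H)) * w) = h * slice k H f w := by
  induction w with
  | zero => simp
  | add x y hx hy => simp only [mul_add, map_add, hx, hy]
  | tmul a b => simp

theorem slice_mul_tmul_one (f : Module.Dual k H) (h : H) (w : H ⊗[k] H) :
    slice k H f (w * (h ⊗ₜ[k] (1 : H))) = slice k H f w * h := by
  induction w with
  | zero => simp
  | add x y hx hy => simp only [add_mul, map_add, hx, hy]
  | tmul a b => simp

/-- `x' m(h x'') = m(x) S(h)` for a left integral `m` and a left cointegral `x`. -/
theorem slice_mulLeft_comul {m : Module.Dual k H} (hm : IsLeftIntegral k H m) {x : H}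
    (hx : x ∈ leftCointegrals k H) (h : H) :
    slice k H (m ∘ₗ LinearMap.mulLeft k h) (comul x) = m x • antipode k h := by
  -- Once h has moved to the first leg as S(h), it leaves the slice, and what remains is the
  -- integral property of m at x.
  rw [← slice_one_tmul_mul, one_tmul_mul_comul hx, slice_tmul_one_mul, hm.slice_comul,
    mul_smul_comm, mul_one]

variable [FiniteDimensional k H]

/-- Every functional is of the form `μ(h ?)`. -/
theorem exists_comp_mulLeft (hS : Function.Injective (antipode k (A := H))) {μ : Module.Dual k H}
    (hμ : IsLeftIntegral k H μ) {x : H} (hx : x ∈ leftCointegrals k H) (hμx : μ x = 1)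
    (f : Module.Dual k H) : ∃ h, μ ∘ₗ LinearMap.mulLeft k h = f := by
  let T : H →ₗ[k] Module.Dual k H := (LinearMap.mul k H).compr₂ μ
  have hT : Function.Injective T := by
    rw [injective_iff_map_eq_zero]
    intro h hh
    -- If μ(h ?) = 0, the slice vanishes, so S(h) = 0.
    have e := slice_mulLeft_comul hμ hx h
    have : μ ∘ₗ LinearMap.mulLeft k h = 0 := hh
    rw [this, hμx, one_smul] at e
    apply hS
    rw [← e]
    simp [slice]
  exact (LinearMap.injective_iff_surjective_of_finrank_eq_finrank
    Subspace.dual_finrank_eq.symm).1 hT f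

/-- Left cointegrals are unique up to scalars. -/
theorem eq_smul_of_mem_leftCointegrals (hS : Function.Injective (antipode k (A := H)))
    {μ : Module.Dual k H} (hμ : IsLeftIntegral k H μ) {x : H} (hx : x ∈ leftCointegrals k H)
    (hμx : μ x = 1) {z : H} (hz : z ∈ leftCointegrals k H) : z = μ z • x := by
  -- The difference y is a left cointegral with μ(y) = 0. For h with μ(h ?) = ε, slicing Δ(y) with
  -- μ(h ?) returns y, while the general formula returns μ(y) S(h) = 0.
  have hy : z - μ z • x ∈ leftCointegrals k H := sub_mem hz (Submodule.smul_mem _ _ hx)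
  obtain ⟨h, hh⟩ := exists_comp_mulLeft hS hμ hx hμx counit
  have e := slice_mulLeft_comul hμ hy h
  rw [hh, slice_counit] at e
  rw [← sub_eq_zero, e]
  simp [hμx]

/-- The slices of `Δ(x)` separate functionals. -/
theorem slice_comul_injective (hS : Function.Bijective (antipode k (A := H)))
    {μ : Module.Dual k H} (hμ : IsLeftIntegral k H μ) {x : H} (hx : x ∈ leftCointegrals k H)
    (hμx : μ x = 1) {f g : Module.Dual k H}
    (h : slice k H f (comul x) = slice k H g (comul x)) : f = g := by
  let T : Module.Dual k H →ₗ[k] H :=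
    { toFun := fun f => slice k H f (comul x)
      map_add' := fun f g => by
        simp [slice_repr _ (ℛ k x), add_smul, Finset.sum_add_distrib]
      map_smul' := fun c f => by
        simp [slice_repr _ (ℛ k x), Finset.smul_sum, mul_smul] }
  have hT : Function.Surjective T := by
    intro a
    obtain ⟨b, rfl⟩ := hS.2 a
    refine ⟨μ ∘ₗ LinearMap.mulLeft k b, ?_⟩
    change slice k H _ _ = _
    rw [slice_mulLeft_comul hμ hx, hμx, one_smul]
  exact (LinearMap.injective_iff_surjective_of_finrank_eq_finrank
    Subspace.dual_finrank_eq).2 hT h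

/-- Left integrals are unique up to scalars. -/
theorem IsLeftIntegral.eq_smul (hS : Function.Bijective (antipode k (A := H)))
    {μ : Module.Dual k H} (hμ : IsLeftIntegral k H μ) {x : H} (hx : x ∈ leftCointegrals k H)
    (hμx : μ x = 1) {m : Module.Dual k H} (hm : IsLeftIntegral k H m) : m = m x • μ := by
  -- Both functionals have the slice m(x) 1 on Δ(x).
  apply slice_comul_injective hS hμ hx hμx
  rw [hm.slice_comul]
  have e := hμ.slice_comul x
  rw [hμx, one_smul, slice_repr _ (ℛ k x)] at e
  rw [slice_repr _ (ℛ k x)]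
  simp only [LinearMap.smul_apply, smul_eq_mul, mul_smul, ← Finset.smul_sum, e]

/-- The modulus attached to `x` and `μ`: `x h = μ(x h) x`. -/
theorem mul_eq_smul_of_mem_leftCointegrals (hS : Function.Injective (antipode k (A := H)))
    {μ : Module.Dual k H} (hμ : IsLeftIntegral k H μ) {x : H} (hx : x ∈ leftCointegrals k H)
    (hμx : μ x = 1) (h : H) : x * h = μ (x * h) • x :=
  eq_smul_of_mem_leftCointegrals hS hμ hx hμx fun a => by
    rw [← mul_assoc, hx a, smul_mul_assoc]

/-- `α(h') μ(z S(h'')) = μ(S⁻¹(h) z)`, where `α` is given by `x h = α(h) x`. -/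
theorem sum_modulus_integral [InvertibleAntipode k H] {μ : Module.Dual k H}
    (hμ : IsLeftIntegral k H μ) {x : H} (hx : x ∈ leftCointegrals k H) (hμx : μ x = 1)
    {ι : Type*} {h : H} (s : Coalgebra.Repr k h ι) (z : H) :
    ∑ i ∈ s.index, μ (x * s.left i) * μ (z * antipode k (s.right i)) =
      μ (antipodeInv k H h * z) := by
  have hS : Function.Bijective (antipode k (A := H)) := InvertibleAntipode.bijective
  let f : Module.Dual k H := ∑ i ∈ s.index,
    μ (x * s.left i) • (μ ∘ₗ LinearMap.mulRight k (antipode k (s.right i)))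
  have hf : f = μ ∘ₗ LinearMap.mulLeft k (antipodeInv k H h) := by
    -- As functionals of z, both sides are compared through their slices of Δ(x), which are both h:
    -- the right side gives S(S⁻¹(h)), and the left side comes from applying μ to x' h ⊗ x'' = α(h')
    -- x' ⊗ x'' S(h'').
    apply slice_comul_injective hS hμ hx hμx
    rw [slice_mulLeft_comul hμ hx, hμx, one_smul, antipode_antipodeInv]
    have e := congrArg (slice k H μ) (comul_mul_tmul_one (χ := μ ∘ₗ LinearMap.mulLeft k x)
      (mul_eq_smul_of_mem_leftCointegrals hS.1 hμ hx hμx) s)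
    rw [slice_mul_tmul_one, hμ.slice_comul, hμx, one_smul, one_mul, map_sum] at e
    rw [e]
    simp only [map_smul, slice_mul_one_tmul]
    simp only [slice_repr _ (ℛ k x), f, LinearMap.sum_apply, LinearMap.smul_apply, Finset.sum_smul,
      Finset.smul_sum, smul_eq_mul, mul_smul]
    exact Finset.sum_comm
  simpa [f] using LinearMap.congr_fun hf z

end Integrals

/-! ### Effect of S⁻¹ on integrals, the modulus of A, and invariance of p under A -/

section IntegralsDouble

variable {k A : Type*} [Field k] [Ring A] [HopfAlgebra k A] [InvertibleAntipode k A]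

theorem antipodeInv_mem_rightCointegrals {x : A} (hx : x ∈ leftCointegrals k A) :
    antipodeInv k A x ∈ rightCointegrals k A := by
  intro h
  have e := congrArg (antipodeInv k A) (hx (antipode k h))
  rwa [antipodeInv_mul, antipodeInv_antipode, counit_antipode, map_smul] at e

theorem antipode_mem_leftCointegrals {r : A} (hr : r ∈ rightCointegrals k A) :
    antipode k r ∈ leftCointegrals k A := by
  intro h
  have e := congrArg (antipode k) (hr (antipodeInv k A h))
  rwa [antipode_mul_antidistrib, antipode_antipodeInv, counit_antipodeInv, map_smul] at e

theorem antipodeInv_mem_leftCointegrals {r : A} (hr : r ∈ rightCointegrals k A) :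
    antipodeInv k A r ∈ leftCointegrals k A := by
  intro h
  have e := congrArg (antipodeInv k A) (hr (antipode k h))
  rwa [antipodeInv_mul, antipodeInv_antipode, counit_antipode, map_smul] at e

variable {μ : Module.Dual k A} {x : A}

/-- Take h = t = S⁻¹(x) in x' μ(h x'') = S(h). Since t is a right cointegral, μ(t ?) = μ(t) ε, so
the left side is μ(t) x, while the right side is S(t) = x. -/
theorem integral_antipodeInv (hμ : IsLeftIntegral k A μ) (hx : x ∈ leftCointegrals k A)
    (hμx : μ x = 1) : μ (antipodeInv k A x) = 1 := by
  have e := slice_mulLeft_comul hμ hx (antipodeInv k A x)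
  have h : μ ∘ₗ LinearMap.mulLeft k (antipodeInv k A x) = μ (antipodeInv k A x) • counit := by
    ext a
    simp [antipodeInv_mem_rightCointegrals hx a, mul_comm]
  have h2 (c : k) : slice k A (c • counit) (comul x) = c • x := by
    rw [slice_repr _ (ℛ k x)]
    simp only [LinearMap.smul_apply, smul_eq_mul, mul_smul, ← Finset.smul_sum]
    rw [← slice_repr, slice_counit]
  rw [h, h2, antipode_antipodeInv, hμx, one_smul] at e
  have := congrArg μ e
  simpa [hμx] using this

/-- `t' μ(t'' h) = S⁻¹(h)` for the right cointegral `t = S⁻¹(x)`. -/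
theorem slice_mulRight_comul (hμ : IsLeftIntegral k A μ) (hx : x ∈ leftCointegrals k A)
    (hμx : μ x = 1) (h : A) : slice k A (μ ∘ₗ LinearMap.mulRight k h)
      (comul (antipodeInv k A x)) = antipodeInv k A h := by
  -- For g = S⁻¹(h) and the right cointegral t, the character is ε, so t' g ⊗ t'' = t' ⊗ t'' S(g);
  -- slicing with μ and using μ(t) = 1 leaves g on the left.
  have e := congrArg (slice k A μ) (comul_mul_tmul_one (χ := counit)
    (antipodeInv_mem_rightCointegrals hx) (ℛ k (antipodeInv k A h)))
  rw [slice_mul_tmul_one, hμ.slice_comul, integral_antipodeInv hμ hx hμx, one_smul, one_mul] at e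
  rw [e]
  simp only [← mul_smul_comm, ← TensorProduct.tmul_smul, ← map_smul]
  rw [← Finset.mul_sum, ← TensorProduct.tmul_sum, ← map_sum, sum_counit_smul,
    antipode_antipodeInv, slice_mul_one_tmul]

/-- `ν = μ ∘ S⁻¹` is a right integral: `ν(h') h'' = ν(h) 1`. -/
theorem sum_integral_antipodeInv (hμ : IsLeftIntegral k A μ) {ι : Type*} {h : A}
    (r : Coalgebra.Repr k h ι) :
    ∑ i ∈ r.index, μ (antipodeInv k A (r.left i)) • r.right i = μ (antipodeInv k A h) • 1 := by
  have e := congrArg (antipode k) (hμ.slice_comul (antipodeInv k A h))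
  rw [slice_repr _ (reprInv r), map_smul, antipode_one, map_sum] at e
  simpa [reprInv, antipode_antipodeInv] using e

/-- S⁻² reverses the coproduct twice, so it is a coalgebra map fixing 1. -/
theorem isLeftIntegral_comp_antipodeInv_sq (hμ : IsLeftIntegral k A μ) :
    IsLeftIntegral k A (μ ∘ₗ antipodeInv k A ∘ₗ antipodeInv k A) := by
  intro h
  have e := congrArg (fun a => antipode k (antipode k a))
    (hμ.slice_comul (antipodeInv k A (antipodeInv k A h)))
  simp only [slice_repr _ (reprInv (reprInv (ℛ k h))), map_smul, antipode_one, map_sum] at e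
  refine (slice_repr _ (ℛ k h)).trans ?_
  simpa [reprInv, antipode_antipodeInv] using e

variable [FiniteDimensional k A]

/-- Uniqueness of left integrals makes μ ∘ S⁻² a multiple of μ; the factor is its value at x, where
μ is 1. -/
theorem integral_antipodeInv_sq (hμ : IsLeftIntegral k A μ) (hx : x ∈ leftCointegrals k A)
    (hμx : μ x = 1) (z : A) : μ (antipodeInv k A (antipodeInv k A z)) =
      μ (antipodeInv k A (antipodeInv k A x)) * μ z :=
  LinearMap.congr_fun (IsLeftIntegral.eq_smul InvertibleAntipode.bijective hμ hx hμx
    (isLeftIntegral_comp_antipodeInv_sq hμ)) z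

/-- By uniqueness of cointegrals the same constant scales x to S⁻²(x); if it were zero, x would be
zero, against μ(x) = 1. -/
theorem integral_antipodeInv_sq_ne_zero (hμ : IsLeftIntegral k A μ)
    (hx : x ∈ leftCointegrals k A) (hμx : μ x = 1) :
    μ (antipodeInv k A (antipodeInv k A x)) ≠ 0 := by
  intro h
  have e := eq_smul_of_mem_leftCointegrals antipode_injective hμ hx hμx
    (antipodeInv_mem_leftCointegrals (antipodeInv_mem_rightCointegrals hx))
  rw [h, zero_smul] at e
  have e2 := congrArg (fun a => μ (antipode k (antipode k a))) e
  simp [antipode_antipodeInv, hμx] at e2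

theorem eq_smul_of_mem_rightCointegrals (hμ : IsLeftIntegral k A μ)
    (hx : x ∈ leftCointegrals k A) (hμx : μ x = 1) {r : A} (hr : r ∈ rightCointegrals k A) :
    r = μ r • antipodeInv k A x := by
  have e := congrArg (antipodeInv k A) (eq_smul_of_mem_leftCointegrals antipode_injective hμ hx hμx
    (antipode_mem_leftCointegrals hr))
  rw [antipodeInv_antipode, map_smul] at e
  have h := congrArg μ e
  rw [map_smul, integral_antipodeInv hμ hx hμx, smul_eq_mul, mul_one] at h
  rwa [← h] at e

/-- The modulus of `A`, as a character. -/
noncomputable def modulus (hμ : IsLeftIntegral k A μ) (hx : x ∈ leftCointegrals k A)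
    (hμx : μ x = 1) : A →ₐ[k] k :=
  AlgHom.ofLinearMap (μ ∘ₗ LinearMap.mulLeft k x) (by simp [hμx]) (fun a b => by
    simp only [LinearMap.comp_apply, LinearMap.mulLeft_apply]
    rw [← mul_assoc, mul_eq_smul_of_mem_leftCointegrals antipode_injective hμ hx hμx a,
      smul_mul_assoc, map_smul, smul_eq_mul]
    simp [hμx])

theorem modulus_apply (hμ : IsLeftIntegral k A μ) (hx : x ∈ leftCointegrals k A)
    (hμx : μ x = 1) (h : A) : modulus hμ hx hμx h = μ (x * h) := rfl

/-- `y t = α(S(y)) t` for the right cointegral `t = S⁻¹(x)`. -/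
theorem mul_antipodeInv_cointegral (hμ : IsLeftIntegral k A μ) (hx : x ∈ leftCointegrals k A)
    (hμx : μ x = 1) (y : A) : y * antipodeInv k A x =
      modulus hμ hx hμx (antipode k y) • antipodeInv k A x := by
  have e := congrArg (antipodeInv k A)
    (mul_eq_smul_of_mem_leftCointegrals antipode_injective hμ hx hμx (antipode k y))
  rwa [antipodeInv_mul, antipodeInv_antipode, map_smul] at e

/-- `α(S(y'')) μ(S⁻¹(y''') ? y') = ε(y) μ`. -/
theorem sum_shift_integral (hμ : IsLeftIntegral k A μ) (hx : x ∈ leftCointegrals k A)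
    (hμx : μ x = 1) (y : A) :
    (toConv (rightShift k A).toLinearMap *
      (toConv (((Algebra.ofId k (Module.End k (CopDual k A))).comp
        (modulus hμ hx hμx)).toLinearMap ∘ₗ antipode k) *
        toConv (leftShift k A).toLinearMap)) y ((toDual k A).symm μ) =
      counit (R := k) y • (toDual k A).symm μ := by
  let a := (Algebra.ofId k (Module.End k (CopDual k A))).comp (modulus hμ hx hμx)
  -- The operator identity for the left shift holds only on the line through μ, so it is stated on
  -- the image of this map.
  let M : k →ₗ[k] CopDual k A := LinearMap.toSpanSingleton k _ ((toDual k A).symm μ)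
  have h (b : A) (w : k) : toConv (leftShift k A).toLinearMap b (M w) =
      (toConv a.toLinearMap * toConv ((rightShift k A).toLinearMap ∘ₗ antipode k)) b (M w) := by
    rw [(ℛ k b).convMul_apply]
    apply CopDual.ext
    intro z
    have e := sum_modulus_integral hμ hx hμx (ℛ k b) z
    change toDual k A (leftShift k A b (w • _)) z = _
    simp only [map_smul, LinearMap.smul_apply, leftShift_apply, LinearEquiv.apply_symm_apply, ← e,
      LinearMap.sum_apply, map_sum, M, LinearMap.toSpanSingleton_apply, Finset.smul_sum]
    refine Finset.sum_congr rfl fun i _ => ?_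
    simp [a, Algebra.ofId_apply, Module.algebraMap_end_apply, rightShift_apply, modulus_apply]
  -- Let R and L be the right and left shifts. On μ, `h` gives L = α ∗ (R ∘ S), so R ∗ (α ∘ S) ∗ L =
  -- R ∗ (α ∘ S) ∗ α ∗ (R ∘ S) = R ∗ (R ∘ S) = 1.
  have h2 := conv_congr (f := toConv (rightShift k A).toLinearMap)
    (conv_congr (f := toConv (a.toLinearMap ∘ₗ antipode k)) h) y 1
  rw [← mul_assoc (toConv (a.toLinearMap ∘ₗ antipode k)), toConv_antipode_mul, one_mul,
    toConv_mul_antipode] at h2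
  have hM : M 1 = (toDual k A).symm μ := one_smul _ _
  rw [hM] at h2
  exact h2

/-- In y·μ·t = μ(S⁻¹(y''') ? y')·y'' t the factor y'' acts on t by the scalar α(S(y'')). The map λ ↦
λ ⊗ t therefore intertwines the three-fold convolution of `sum_shift_integral` with the action of y
on A° ⊗ A. -/
theorem ofA_mul_canonicalElement (hμ : IsLeftIntegral k A μ) (hx : x ∈ leftCointegrals k A)
    (hμx : μ x = 1) (y : A) : ofA k A y * canonicalElement k A μ x =
      counit (R := k) y • canonicalElement k A μ x := by
  rw [canonicalElement, ofDual_mul_ofA, ofA_mul]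
  have h := Intertwines.mul (A := A)
    (M := (TensorProduct.mk k (CopDual k A) A).flip (antipodeInv k A x))
    (g := toConv (rightShift k A).toLinearMap) (f := toConv (repR A).toLinearMap)
    (fun a w => rfl)
    (Intertwines.mul (g := toConv (((Algebra.ofId k (Module.End k (CopDual k A))).comp
        (modulus hμ hx hμx)).toLinearMap ∘ₗ antipode k))
      (f := toConv (repM (Algebra.lmul k A)).toLinearMap)
      (g' := toConv (leftShift k A).toLinearMap) (f' := toConv (repL A).toLinearMap)
      (fun a w => by
        change _ = w ⊗ₜ[k] (a * antipodeInv k A x)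
        rw [mul_antipodeInv_cointegral hμ hx hμx]
        simp [Algebra.ofId_apply, Module.algebraMap_end_apply])
      (fun a w => rfl)) y ((toDual k A).symm μ)
  rw [← act_toConv, sum_shift_integral, map_smul] at h
  rw [← map_smul]
  exact congrArg (of k A) h.symm

end IntegralsDouble

/-! ### The composite of canonical maps in the formula for P -/

section ProjectorFormula

variable {k A : Type*} [Field k] [Ring A] [HopfAlgebra k A]

variable (k A) in
/-- The map `y ⊗ λ ↦ ⟨λ, S²(y'')⟩ y'`. -/
noncomputable def contractComul : A ⊗[k] Module.Dual k A →ₗ[k] A :=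
  (TensorProduct.rid k A).toLinearMap ∘ₗ (contractLeft k A).lTensor A ∘ₗ
  ((antipode k ∘ₗ antipode k).lTensor (Module.Dual k A)).lTensor A ∘ₗ
  (TensorProduct.comm k A (Module.Dual k A)).toLinearMap.lTensor A ∘ₗ
  (TensorProduct.assoc k A A (Module.Dual k A)).toLinearMap ∘ₗ
    (comul (R := k) (A := A)).rTensor (Module.Dual k A)

theorem contractComul_tmul (y : A) (f : Module.Dual k A) {ι : Type*} (r : Coalgebra.Repr k y ι) :
    contractComul k A (y ⊗ₜ f) =
      ∑ i ∈ r.index, f (antipode k (antipode k (r.right i))) • r.left i := by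
  simp only [contractComul, LinearMap.comp_apply, LinearMap.rTensor_tmul, ← r.eq,
    TensorProduct.sum_tmul, map_sum]
  simp

variable [FiniteDimensional k A]

theorem projectorFormula_apply (y : A) : projectorFormula k A y =
    contractComul k A (∑ i, (Module.Basis.ofVectorSpace k A i * y) ⊗ₜ[k]
      (Module.Basis.ofVectorSpace k A).coord i) := by
  simp [projectorFormula, contractComul, coevaluation_apply_one, TensorProduct.sum_tmul]

end ProjectorFormula

/-! ### Antipode invariance of p, and unimodularity of the double -/

section IntegralsDouble

variable {k A : Type*} [Field k] [Ring A] [HopfAlgebra k A] [InvertibleAntipode k A]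
  {μ : Module.Dual k A} {x : A}

variable (k A) in
/-- The slice map `λ · a ↦ λ(z) a` on `D(A)`. -/
noncomputable def evalDual (z : A) : DrinfeldDouble k A →ₗ[k] A :=
  (TensorProduct.lid k A).toLinearMap ∘ₗ
    (LinearMap.applyₗ z ∘ₗ (toDual k A).toLinearMap).rTensor A ∘ₗ (of k A).symm.toLinearMap

theorem evalDual_of (z : A) (l : CopDual k A) (a : A) :
    evalDual k A z (of k A (l ⊗ₜ a)) = toDual k A l z • a := by
  simp [evalDual]

theorem evalDual_mul_ofA (z : A) (w : DrinfeldDouble k A) (h : A) :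
    evalDual k A z (w * ofA k A h) = evalDual k A z w * h := by
  induction w using ind with
  | h0 => simp
  | hadd x y hx hy => simp only [add_mul, map_add, hx, hy]
  | h l a => rw [← ofDual_mul_ofA, mul_assoc, ← map_mul, ofDual_mul_ofA, ofDual_mul_ofA,
      evalDual_of, evalDual_of, smul_mul_assoc]

/-- The left integral `λ · y ↦ λ(t) μ(y)` of `D(A)`. -/
noncomputable def doubleIntegral (μ : Module.Dual k A) (t : A) :
    Module.Dual k (DrinfeldDouble k A) := μ ∘ₗ evalDual k A t

theorem doubleIntegral_of (μ : Module.Dual k A) (t : A) (l : CopDual k A) (y : A) :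
    doubleIntegral μ t (of k A (l ⊗ₜ y)) = toDual k A l t * μ y := by
  simp [doubleIntegral, evalDual_of]

/-- `x' ν(S(x'') h) = h` for `ν = μ ∘ S⁻¹`. -/
theorem sum_integral_antipode_mul (hμ : IsLeftIntegral k A μ) (hx : x ∈ leftCointegrals k A)
    (hμx : μ x = 1) {ι : Type*} (r : Coalgebra.Repr k x ι) (h : A) :
    ∑ i ∈ r.index, μ (antipodeInv k A (antipode k (r.right i) * h)) • r.left i = h := by
  have e := slice_mulLeft_comul hμ hx (antipodeInv k A h)
  rw [slice_repr _ r, hμx, one_smul, antipode_antipodeInv] at e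
  simpa [antipodeInv_mul, antipodeInv_antipode] using e

theorem doubleIntegral_canonicalElement (hμ : IsLeftIntegral k A μ) (hx : x ∈ leftCointegrals k A)
    (hμx : μ x = 1) :
    doubleIntegral μ (antipodeInv k A x) (canonicalElement k A μ x) = 1 := by
  rw [canonicalElement, ofDual_mul_ofA, doubleIntegral_of, LinearEquiv.apply_symm_apply,
    integral_antipodeInv hμ hx hμx, one_mul]

/-- `ν(ν(S⁻¹(x''') z x') x'') = μ(S⁻²(z))` for `ν = μ ∘ S⁻¹`. -/
theorem integral_evalDual (hμ : IsLeftIntegral k A μ) (hx : x ∈ leftCointegrals k A)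
    (hμx : μ x = 1) (z : A) :
    μ (antipodeInv k A (evalDual k A z
      (ofA k A x * ofDual k A ((toDual k A).symm (μ ∘ₗ antipodeInv k A))))) =
      μ (antipodeInv k A (antipodeInv k A z)) := by
  -- The target is written with S⁻²(z) = t' μ(t'' S⁻¹(z)), where Δ(t) = S⁻¹(x'') ⊗ S⁻¹(x').
  rw [ofA_mul_ofDual (ℛ k x) (fun i => ℛ k ((ℛ k x).right i)), ← slice_mulRight_comul hμ hx hμx (antipodeInv k A z),
    slice_repr _ (reprInv (ℛ k x))]
  simp only [ofDual_mul_ofA, map_sum, evalDual_of, map_smul, smul_eq_mul, rightShift_apply,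
    leftShift_apply, LinearEquiv.apply_symm_apply, LinearMap.comp_apply, reprInv,
    LinearMap.mulRight_apply]
  refine Finset.sum_congr rfl fun i _ => ?_
  -- With the first leg of x fixed, the right integral property of ν on the other two replaces
  -- ν(x'') S⁻¹(x''') by the scalar ν of their common source.
  have e := sum_integral_antipodeInv hμ (ℛ k ((ℛ k x).right i))
  have e2 := congrArg (fun a => μ (antipodeInv k A (antipodeInv k A a * (z * (ℛ k x).left i)))) e
  simp only [map_sum, map_smul, Finset.sum_mul, smul_mul_assoc, smul_eq_mul, antipodeInv_one,
    one_mul] at e2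
  rw [← antipodeInv_mul]
  exact (Finset.sum_congr rfl fun j _ => mul_comm _ _).trans (e2.trans (mul_comm _ _))

theorem canonicalElement_ne_zero (hμ : IsLeftIntegral k A μ) (hx : x ∈ leftCointegrals k A)
    (hμx : μ x = 1) : canonicalElement k A μ x ≠ 0 := by
  intro h
  simpa [h] using doubleIntegral_canonicalElement hμ hx hμx

variable [FiniteDimensional k A]

theorem antipode_canonicalElement_eq (μ : Module.Dual k A) (x : A) :
    antipode k (canonicalElement k A μ x) =
      ofA k A x * ofDual k A ((toDual k A).symm (μ ∘ₗ antipodeInv k A)) := by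
  rw [canonicalElement, antipode_mul_antidistrib, antipode_ofA, antipode_ofDual,
    antipode_antipodeInv]
  rfl

/-- Under A° ⊗ A = Hom(A, A), the slices of an element are the values of the corresponding map. -/
theorem ext_evalDual {v w : DrinfeldDouble k A} (h : ∀ z, evalDual k A z v = evalDual k A z w) :
    v = w := by
  let T : DrinfeldDouble k A ≃ₗ[k] (A →ₗ[k] A) := (of k A).symm ≪≫ₗ
    TensorProduct.congr (toDual k A) (LinearEquiv.refl k A) ≪≫ₗ dualTensorHomEquiv k A A
  have hT (u : DrinfeldDouble k A) (z : A) : T u z = evalDual k A z u := by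
    induction u using ind with
    | h0 => simp
    | hadd x y hx hy => simp only [map_add, LinearMap.add_apply, hx, hy]
    | h l a => rw [evalDual_of]; simp [T]
  apply T.injective
  ext z
  rw [hT, hT, h]

theorem antipode_canonicalElement (hμ : IsLeftIntegral k A μ) (hx : x ∈ leftCointegrals k A)
    (hμx : μ x = 1) : antipode k (canonicalElement k A μ x) = canonicalElement k A μ x := by
  have hq (h : A) : antipode k (canonicalElement k A μ x) * ofA k A h =
      counit (R := k) h • antipode k (canonicalElement k A μ x) := by
    have e := congrArg (antipode k) (ofA_mul_canonicalElement hμ hx hμx (antipodeInv k A h))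
    rwa [antipode_mul_antidistrib, antipode_ofA, antipode_antipodeInv, counit_antipodeInv,
      map_smul] at e
  apply ext_evalDual
  intro z
  -- Slicing along A° commutes with right multiplication by A, so right invariance of S(p) under A
  -- passes to each slice.
  have hr : evalDual k A z (antipode k (canonicalElement k A μ x)) ∈ rightCointegrals k A := by
    intro h
    rw [← evalDual_mul_ofA, hq, map_smul]
  have e := eq_smul_of_mem_rightCointegrals hμ hx hμx hr
  -- The slice is c t with c to be found. Applying ν gives μ(S⁻²(x)) μ(z) = c μ(S⁻²(x)), since ν(t)
  -- = μ(S⁻²(x)); cancelling the nonzero constant gives c = μ(z), the slice coefficient of p.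
  have h := congrArg (fun a => μ (antipodeInv k A a)) e
  simp only [map_smul, smul_eq_mul] at h
  rw [antipode_canonicalElement_eq, integral_evalDual hμ hx hμx,
    integral_antipodeInv_sq hμ hx hμx, mul_comm] at h
  rw [e, antipode_canonicalElement_eq, ← mul_right_cancel₀
    (integral_antipodeInv_sq_ne_zero hμ hx hμx) h, canonicalElement, ofDual_mul_ofA, evalDual_of,
    LinearEquiv.apply_symm_apply]

/-- For the convolution product, a left integral on A is a left cointegral of A°: λ(a') μ(a'') =
λ(1) μ(a). -/
theorem ofDual_mul_canonicalElement (hμ : IsLeftIntegral k A μ) (x : A) (l : CopDual k A) :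
    ofDual k A l * canonicalElement k A μ x =
      counit (R := k) l • canonicalElement k A μ x := by
  have h : l * (toDual k A).symm μ = counit (R := k) l • (toDual k A).symm μ := by
    apply CopDual.ext
    intro a
    have e := congrArg (toDual k A l) (hμ.slice_comul a)
    rw [slice_repr _ (ℛ k a), map_sum] at e
    rw [toDual_mul _ _ (ℛ k a), counit_dual, map_smul, LinearMap.smul_apply]
    simpa [mul_comm] using e
  rw [canonicalElement, ← mul_assoc, ← map_mul, h, map_smul, smul_mul_assoc]

theorem canonicalElement_mem_leftCointegrals (hμ : IsLeftIntegral k A μ)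
    (hx : x ∈ leftCointegrals k A) (hμx : μ x = 1) :
    canonicalElement k A μ x ∈ leftCointegrals k (DrinfeldDouble k A) := by
  intro w
  induction w using ind with
  | h0 => simp
  | hadd x y hx hy => rw [add_mul, hx, hy, map_add, add_smul]
  | h l a => rw [← ofDual_mul_ofA, mul_assoc, ofA_mul_canonicalElement hμ hx hμx, mul_smul_comm,
      ofDual_mul_canonicalElement hμ, ofDual_mul_ofA, counit_of, mul_smul]

instance : FiniteDimensional k (DrinfeldDouble k A) := Module.Finite.equiv (of k A)

/-- Needed to apply uniqueness of cointegrals to D(A). Products y·λ span D(A), and S(m·S⁻¹(y)) =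
y·S(m), with S surjective on A°. -/
theorem antipode_double_bijective :
    Function.Bijective (antipode k (A := DrinfeldDouble k A)) := by
  have hs : Function.Surjective (antipode k (A := DrinfeldDouble k A)) := by
    intro w
    obtain ⟨v, rfl⟩ := mulMap_bijective.2 w
    induction v with
    | zero => exact ⟨0, by simp⟩
    | add x y hx hy =>
      obtain ⟨a, ha⟩ := hx
      obtain ⟨b, hb⟩ := hy
      exact ⟨a + b, by rw [map_add, ha, hb, map_add]⟩
    | tmul y l =>
      obtain ⟨m, rfl⟩ := antipode_dual_surjective (k := k) l
      exact ⟨of k A (m ⊗ₜ antipodeInv k A y), by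
        rw [antipode_of, antipode_antipodeInv]; simp [mulMap]⟩
  exact ⟨LinearMap.injective_iff_surjective.2 hs, hs⟩

theorem canonicalElement_mem_rightCointegrals (hμ : IsLeftIntegral k A μ)
    (hx : x ∈ leftCointegrals k A) (hμx : μ x = 1) :
    canonicalElement k A μ x ∈ rightCointegrals k (DrinfeldDouble k A) := by
  intro w
  obtain ⟨v, rfl⟩ := antipode_double_bijective.2 w
  rw [← antipode_canonicalElement hμ hx hμx, ← antipode_mul_antidistrib,
    canonicalElement_mem_leftCointegrals hμ hx hμx, map_smul, counit_antipode]

/-- The coalgebra D(A) is A° ⊗ A, so a product of left integrals suffices. Evaluation at t is one on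
A° because its comultiplication is opposite: λ'(a) λ''(t) = λ(t a) = ε(a) λ(t). -/
theorem isLeftIntegral_doubleIntegral (hμ : IsLeftIntegral k A μ) {t : A}
    (ht : t ∈ rightCointegrals k A) :
    IsLeftIntegral k (DrinfeldDouble k A) (doubleIntegral μ t) := by
  intro w
  change slice k _ _ _ = _
  induction w using ind with
  | h0 => simp
  | hadd x y hx hy => simp only [map_add, hx, hy, add_smul]
  | h l y =>
    have h1 : ∑ i ∈ (ℛ k l).index, toDual k A ((ℛ k l).right i) t • (ℛ k l).left i =
        toDual k A l t • 1 := by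
      apply CopDual.ext
      intro a
      have e := pair2_comul l a t
      rw [ht a, ← (ℛ k l).eq] at e
      simpa [pair2_tmul, toDual_one, mul_comm] using e
    have h2 := hμ.slice_comul y
    rw [slice_repr _ (ℛ k y)] at h2
    rw [slice_repr _ (reprOf (ℛ k l) (ℛ k y)), doubleIntegral_of]
    simp only [reprOf, doubleIntegral_of, Finset.sum_product]
    calc _ = of k A ((∑ i ∈ (ℛ k l).index, toDual k A ((ℛ k l).right i) t • (ℛ k l).left i) ⊗ₜ
          (∑ i ∈ (ℛ k y).index, μ ((ℛ k y).right i) • (ℛ k y).left i)) := by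
          simp only [TensorProduct.sum_tmul, TensorProduct.tmul_sum, map_sum,
            TensorProduct.smul_tmul_smul, map_smul]
          exact Finset.sum_comm
      _ = _ := by
          rw [h1, h2, TensorProduct.smul_tmul_smul, map_smul, one_def]

/-- The Drinfeld double is unimodular. -/
theorem isModulus_double_iff (hμ : IsLeftIntegral k A μ) (hx : x ∈ leftCointegrals k A)
    (hμx : μ x = 1) (α : DrinfeldDouble k A →ₐ[k] k) :
    IsModulus k (DrinfeldDouble k A) α ↔ α = Bialgebra.counitAlgHom k (DrinfeldDouble k A) := by
  have hr := canonicalElement_mem_rightCointegrals hμ hx hμx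
  constructor
  · intro hα
    ext w
    -- Testing on p alone suffices: p w = ε(w) p and p ≠ 0.
    have e := hα _ (canonicalElement_mem_leftCointegrals hμ hx hμx) w
    rw [hr] at e
    exact (smul_left_injective k (canonicalElement_ne_zero hμ hx hμx) e).symm
  · rintro rfl z hz w
    -- Uniqueness in D(A), for the pair formed by the double integral and p, makes z a multiple of
    -- the two-sided cointegral p.
    rw [eq_smul_of_mem_leftCointegrals antipode_double_bijective.1
      (isLeftIntegral_doubleIntegral hμ (antipodeInv_mem_rightCointegrals hx))
      (canonicalElement_mem_leftCointegrals hμ hx hμx)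
      (doubleIntegral_canonicalElement hμ hx hμx) hz, smul_mul_assoc, hr, smul_comm]
    rfl

/-! ### The endomorphism P and its closed formula -/

theorem toEnd_canonicalElement (hμ : IsLeftIntegral k A μ) (hx : x ∈ leftCointegrals k A)
    (hμx : μ x = 1) (z : A) :
    toEnd k A (canonicalElement k A μ x) z = μ (antipodeInv k A z) • x := by
  -- Rewriting p as S(p) = x·ν puts it in the order A·A°, where the inverse of the multiplication
  -- map can be read off.
  rw [← antipode_canonicalElement hμ hx hμx, antipode_canonicalElement_eq, toEnd_mul,
    LinearEquiv.apply_symm_apply]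
  rfl

theorem leftCointegrals_eq_span (hμ : IsLeftIntegral k A μ) (hx : x ∈ leftCointegrals k A)
    (hμx : μ x = 1) : leftCointegrals k A = Submodule.span k {x} := by
  apply le_antisymm
  · intro z hz
    rw [eq_smul_of_mem_leftCointegrals antipode_injective hμ hx hμx hz]
    exact Submodule.smul_mem _ _ (Submodule.mem_span_singleton_self x)
  · rwa [Submodule.span_singleton_le_iff_mem]

theorem range_toEnd_canonicalElement (hμ : IsLeftIntegral k A μ) (hx : x ∈ leftCointegrals k A)
    (hμx : μ x = 1) :
    LinearMap.range (toEnd k A (canonicalElement k A μ x)) = leftCointegrals k A := by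
  apply le_antisymm
  · rintro _ ⟨z, rfl⟩
    rw [toEnd_canonicalElement hμ hx hμx]
    exact Submodule.smul_mem _ _ hx
  · intro z hz
    refine ⟨μ z • x, ?_⟩
    rw [map_smul, toEnd_canonicalElement hμ hx hμx, integral_antipodeInv hμ hx hμx, one_smul]
    exact (eq_smul_of_mem_leftCointegrals antipode_injective hμ hx hμx hz).symm

/-- `∑ eᵢ y ⊗ fᵢ = x' ⊗ ν(S(x'') ? y)`. -/
theorem sum_basis_mul_tmul_coord (hμ : IsLeftIntegral k A μ) (hx : x ∈ leftCointegrals k A)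
    (hμx : μ x = 1) {ι κ : Type*} [Fintype κ] (b : Module.Basis κ k A) (r : Coalgebra.Repr k x ι)
    (y : A) : ∑ i, (b i * y) ⊗ₜ[k] b.coord i = ∑ i ∈ r.index, r.left i ⊗ₜ[k]
      (μ ∘ₗ antipodeInv k A ∘ₗ LinearMap.mulLeft k (antipode k (r.right i)) ∘ₗ
        LinearMap.mulRight k y) := by
  -- Seen as endomorphisms of A, both sides are h ↦ h y; on the right this is x' ν(S(x'') h y) = h
  -- y.
  let T := TensorProduct.comm k A (Module.Dual k A) ≪≫ₗ dualTensorHomEquiv k A A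
  apply T.injective
  ext h
  have e := congrArg (· * y) (b.sum_repr h)
  simp only [Finset.sum_mul, smul_mul_assoc] at e
  simp only [T, map_sum, LinearMap.sum_apply]
  simpa [e] using (sum_integral_antipode_mul hμ hx hμx r (h * y)).symm

theorem projectorFormula_eq (hμ : IsLeftIntegral k A μ) (hx : x ∈ leftCointegrals k A)
    (hμx : μ x = 1) (y : A) : projectorFormula k A y = μ (antipodeInv k A y) • x := by
  -- Here g(a ⊗ b) = ν(S(b) S²(a) y). On Δ(a) it collapses to ε(a) ν(y), because S(a'') S²(a') =
  -- S(S(a') a'').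
  let g : Module.Dual k (A ⊗[k] A) := μ ∘ₗ antipodeInv k A ∘ₗ LinearMap.mulRight k y ∘ₗ
    LinearMap.mul' k A ∘ₗ TensorProduct.map (antipode k) (antipode k ∘ₗ antipode k) ∘ₗ
      (TensorProduct.comm k A A).toLinearMap
  have hg (a : A) : g (comul a) = μ (antipodeInv k A y) * counit (R := k) a := by
    have e := congrArg (antipode k) (sum_antipode_mul_eq_smul (R := k) (ℛ k a))
    simp only [map_sum, antipode_mul_antidistrib, map_smul, antipode_one] at e
    have e2 := congrArg (fun b => μ (antipodeInv k A (b * y))) e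
    simp only [smul_mul_assoc, map_smul, one_mul, smul_eq_mul, mul_comm (counit a)] at e2
    rw [← e2, ← (ℛ k a).eq]
    simp [g, Finset.sum_mul]
  rw [projectorFormula_apply, sum_basis_mul_tmul_coord hμ hx hμx _ (ℛ k x), map_sum]
  -- Inserting the expansion of ∑ eᵢy ⊗ fᵢ gives x' g(x'' ⊗ x''') with the first leg of Δ(x) split.
  -- Coassociativity moves the splitting to the second leg, where g applies to a coproduct.
  have e := congrArg (fun w => TensorProduct.rid k A (g.lTensor A w))
    (Coalgebra.coassoc_apply (R := k) x)
  simp only [← (ℛ k x).eq, map_sum, LinearMap.rTensor_tmul, LinearMap.lTensor_tmul, hg,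
    TensorProduct.rid_tmul, mul_smul] at e
  rw [← Finset.smul_sum, ← slice_repr, slice_counit] at e
  rw [← e]
  refine Finset.sum_congr rfl fun i _ => ?_
  rw [contractComul_tmul _ _ (ℛ k ((ℛ k x).left i)), ← (ℛ k ((ℛ k x).left i)).eq]
  simp [TensorProduct.sum_tmul, g, mul_assoc]

end IntegralsDouble

end HopfDouble

theorem mainTheorem8 {k A : Type*} [Field k] [Ring A] [HopfAlgebra k A] [FiniteDimensional k A]
    [HopfDouble.InvertibleAntipode k A]
    (μ : Module.Dual k A) (hμ : HopfDouble.IsLeftIntegral k A μ)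
    (x : A) (hx : x ∈ HopfDouble.leftCointegrals k A) (hμx : μ x = 1) :
    let D := HopfDouble.DrinfeldDouble k A
    let p : D := HopfDouble.canonicalElement k A μ x
    let P : A →ₗ[k] A := HopfDouble.DrinfeldDouble.toEnd k A p
    HopfAlgebra.antipode k p = p ∧
    (p ≠ 0 ∧ p ∈ HopfDouble.leftCointegrals k D ∧ p ∈ HopfDouble.rightCointegrals k D ∧
      ∀ α : D →ₐ[k] k, HopfDouble.IsModulus k D α ↔ α = Bialgebra.counitAlgHom k D) ∧
    (P ∘ₗ P = P ∧ LinearMap.range P = HopfDouble.leftCointegrals k A ∧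
      Module.finrank k (LinearMap.range P) = 1 ∧
      P = HopfDouble.projectorFormula k A) := by
  intro D p P
  have hP (z : A) : P z = μ (HopfDouble.antipodeInv k A z) • x :=
    HopfDouble.toEnd_canonicalElement hμ hx hμx z
  have hrange : LinearMap.range P = HopfDouble.leftCointegrals k A :=
    HopfDouble.range_toEnd_canonicalElement hμ hx hμx
  refine ⟨HopfDouble.antipode_canonicalElement hμ hx hμx,
    ⟨HopfDouble.canonicalElement_ne_zero hμ hx hμx,
      HopfDouble.canonicalElement_mem_leftCointegrals hμ hx hμx,
      HopfDouble.canonicalElement_mem_rightCointegrals hμ hx hμx,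
      HopfDouble.isModulus_double_iff hμ hx hμx⟩, ?_, hrange, ?_, ?_⟩
  -- P² = P amounts to ν(x) = μ(S⁻¹(x)) = 1.
  · ext z
    rw [LinearMap.comp_apply, hP z, map_smul, hP x,
      HopfDouble.integral_antipodeInv hμ hx hμx, one_smul]
  · rw [hrange, HopfDouble.leftCointegrals_eq_span hμ hx hμx]
    refine finrank_span_singleton ?_
    rintro rfl
    simp at hμx
  · ext z
    rw [hP, HopfDouble.projectorFormula_eq hμ hx hμx]
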